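/- For a set $V$ of points of $\mathbb{Z}^2$, the \emph{square grid graph} on $V$ is the graph with vertex set $V$ in which two points are adjacent if and only if their distance is $1$; it is drawn in $\mathbb{R}^2$ with straight edges, and its faces are the connected components of the complement of this drawing. It is \emph{solid} if every bounded face is a pixel, i.e. an open unit square $(a,a+1)\times(b,b+1)$, $a,b\in\mathbb{Z}$, whose four corners belong to $V$. A \emph{double turning Hamiltonian cycle} of the graph is a closed walk of positive length that visits every vertex at least once, uses no edge more than once, and turns by $90^\circ$ at every vertex it passes (including at its base point, between its last and its first edge). \textbf{Theorem.} The problem of deciding whether a given finite solid square grid graph has a double turning Hamiltonian cycle is solvable in linear time. Precisely: there are a single random access machine program and constants $c,k$ such that, for every finite set $V\subset\mathbb{Z}^2$ whose square grid graph is solid (connected or not), with the points of $V$ given as a list of their coordinates in an arbitrary order, the program halts after at most $c\,(|V|+1)$ steps and outputs $1$ if the graph has a double turning Hamiltonian cycle and $0$ if it has none. Here the machine has registers and an indirectly addressed memory that is zero outside the input; each arithmetic operation ($+,-,\times$, integer division), constant assignment, load, store, empty instruction and comparison is one step; and all integers computed have absolute value at most $(M+2)^k$, where $M$ is the maximum of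 $|V|$ and the absolute values of the coordinates of the points of $V$ (words of $O(\log (M+2))$ bits). -/

import Mathlib

namespace DoubleTurning

/-! ### Square grid graphs -/

/-- The full square grid: lattice points of the plane, joined when at (Euclidean) distance one. -/
def squareLattice : SimpleGraph (ℤ × ℤ) where
  Adj p q := (p.1 - q.1) ^ 2 + (p.2 - q.2) ^ 2 = 1
  symm := ⟨fun p q h => by rw [← h]; ring⟩
  loopless := ⟨fun p h => by simp at h⟩

/-- The square grid graph induced by a set `V` of lattice points. -/
abbrev gridGraph (V : Set (ℤ × ℤ)) : SimpleGraph V := squareLattice.induce V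

/-- A lattice point as a point of the plane. -/
def toPlane (p : ℤ × ℤ) : ℝ × ℝ := ((p.1 : ℝ), (p.2 : ℝ))

/-- The drawing of the grid graph on `V`: its vertices, and its edges as straight segments. -/
def drawing (V : Set (ℤ × ℤ)) : Set (ℝ × ℝ) :=
  toPlane '' V ∪
    {z | ∃ p ∈ V, ∃ q ∈ V, squareLattice.Adj p q ∧ z ∈ segment ℝ (toPlane p) (toPlane q)}

/-- `F` is a face of the grid graph on `V`: a connected component of the complement of its
drawing. -/
def IsFace (V : Set (ℤ × ℤ)) (F : Set (ℝ × ℝ)) : Prop :=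
  ∃ z ∈ (drawing V)ᶜ, F = connectedComponentIn (drawing V)ᶜ z

/-- `F` is (the open region of) a pixel of the grid graph on `V`: an open unit tile of the square
tessellation all of whose corners (hence also all of whose sides) belong to the graph. -/
def IsPixel (V : Set (ℤ × ℤ)) (F : Set (ℝ × ℝ)) : Prop :=
  ∃ a b : ℤ, (a, b) ∈ V ∧ (a + 1, b) ∈ V ∧ (a, b + 1) ∈ V ∧ (a + 1, b + 1) ∈ V ∧
    F = Set.Ioo (a : ℝ) (a + 1) ×ˢ Set.Ioo (b : ℝ) (b + 1)

/-- The grid graph on `V` is solid: every bounded face is a pixel. -/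
def IsSolid (V : Set (ℤ × ℤ)) : Prop :=
  ∀ F, IsFace V F → Bornology.IsBounded F → IsPixel V F

/-! ### Double turning Hamiltonian cycles -/

/-- Going from `a` to `b` and then to `c`, one turns at `b`: the two steps are perpendicular. -/
def Turns (a b c : ℤ × ℤ) : Prop :=
  (b.1 - a.1) * (c.1 - b.1) + (b.2 - a.2) * (c.2 - b.2) = 0

/-- The grid graph on `V` has a nontrivial closed walk that uses no edge twice, visits every vertex
(at least once), and turns at every vertex it passes, including the passage through the base point
from its last edge to its first edge. -/
def HasDoubleTurningCycle (V : Set (ℤ × ℤ)) : Prop :=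
  ∃ (v : V) (w : (gridGraph V).Walk v v),
    w.IsCircuit ∧ (∀ u : V, u ∈ w.support) ∧
      ∀ i < w.length,
        Turns (w.getVert i) (w.getVert (i + 1)) (w.getVert ((i + 1) % w.length + 1))

/-! ### Random access machines -/

/-- The state of a random access machine: registers, which programs name directly, and a
memory, which programs address indirectly. -/
structure State where
  reg : ℕ → ℤ
  mem : ℕ → ℤ

/-- The state with register `d` overwritten by `z`. -/
def State.setReg (σ : State) (d : ℕ) (z : ℤ) : State :=
  { σ with reg := Function.update σ.reg d z }

/-- The state with memory cell `a` overwritten by `z`. -/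
def State.setMem (σ : State) (a : ℕ) (z : ℤ) : State :=
  { σ with mem := Function.update σ.mem a z }

/-- The arithmetic operations of the machine. -/
inductive BinOp
  | add
  | sub
  | mul
  | div

/-- The value of an arithmetic operation (`div` is integer division with nonnegative remainder,
and division by zero gives zero). -/
def BinOp.eval : BinOp → ℤ → ℤ → ℤ
  | .add, x, y => x + y
  | .sub, x, y => x - y
  | .mul, x, y => x * y
  | .div, x, y => x / y

/-- Comparisons of the contents of two registers. -/
inductive Test
  | lt (a b : ℕ)
  | eq (a b : ℕ)

/-- The comparison succeeds in the given state. -/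
def Test.Holds : Test → State → Prop
  | .lt a b, σ => σ.reg a < σ.reg b
  | .eq a b, σ => σ.reg a = σ.reg b

/-- Programs of the machine. Registers are named by natural numbers. -/
inductive Prog
  /-- Do nothing. -/
  | skip
  /-- Write the constant `z` to register `d`. -/
  | const (d : ℕ) (z : ℤ)
  /-- Apply `o` to the contents of the registers `a` and `b`, with the result in register `d`. -/
  | op (o : BinOp) (d a b : ℕ)
  /-- Copy to register `d` the memory cell whose address is in register `a`. -/
  | load (d a : ℕ)
  /-- Copy register `s` to the memory cell whose address is in register `a`. -/
  | store (a s : ℕ)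
  /-- Run `p`, then `q`. -/
  | seq (p q : Prog)
  /-- Run `p` if the test succeeds, otherwise `q`. -/
  | ite (b : Test) (p q : Prog)
  /-- Run `p` as long as the test succeeds. -/
  | loop (b : Test) (p : Prog)

/-- `Exec B P σ t τ`: started in state `σ`, the program `P` halts in state `τ` after `t` steps, on a
machine whose words hold the integers of absolute value at most `B`. Every elementary instruction
and every evaluation of a test is one step. A run that computes an integer which does not fit in a
word, or that addresses a negative memory cell, gets stuck. -/
inductive Exec (B : ℕ) : Prog → State → ℕ → State → Prop
  | skip (σ : State) : Exec B .skip σ 1 σ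
  | const (σ : State) (d : ℕ) (z : ℤ) (hz : |z| ≤ (B : ℤ)) :
      Exec B (.const d z) σ 1 (σ.setReg d z)
  | op (σ : State) (o : BinOp) (d a b : ℕ) (hz : |o.eval (σ.reg a) (σ.reg b)| ≤ (B : ℤ)) :
      Exec B (.op o d a b) σ 1 (σ.setReg d (o.eval (σ.reg a) (σ.reg b)))
  | load (σ : State) (d a : ℕ) (ha : 0 ≤ σ.reg a) :
      Exec B (.load d a) σ 1 (σ.setReg d (σ.mem (σ.reg a).toNat))
  | store (σ : State) (a s : ℕ) (ha : 0 ≤ σ.reg a) :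
      Exec B (.store a s) σ 1 (σ.setMem (σ.reg a).toNat (σ.reg s))
  | seq {p q : Prog} {σ₀ σ₁ σ₂ : State} {m n : ℕ} (hp : Exec B p σ₀ m σ₁)
      (hq : Exec B q σ₁ n σ₂) : Exec B (.seq p q) σ₀ (m + n) σ₂
  | iteTrue {b : Test} {p q : Prog} {σ₀ σ₁ : State} {m : ℕ} (hb : b.Holds σ₀)
      (hp : Exec B p σ₀ m σ₁) : Exec B (.ite b p q) σ₀ (1 + m) σ₁
  | iteFalse {b : Test} {p q : Prog} {σ₀ σ₁ : State} {m : ℕ} (hb : ¬ b.Holds σ₀)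
      (hq : Exec B q σ₀ m σ₁) : Exec B (.ite b p q) σ₀ (1 + m) σ₁
  | loopDone {b : Test} {p : Prog} {σ : State} (hb : ¬ b.Holds σ) : Exec B (.loop b p) σ 1 σ
  | loopStep {b : Test} {p : Prog} {σ₀ σ₁ σ₂ : State} {m n : ℕ} (hb : b.Holds σ₀)
      (hp : Exec B p σ₀ m σ₁) (hl : Exec B (.loop b p) σ₁ n σ₂) :
      Exec B (.loop b p) σ₀ (1 + m + n) σ₂

/-- The initial state for a list of lattice points: their number is in register `0`, the coordinates
of the `i`-th point (counted from zero) are in the memory cells `2 * i` and `2 * i + 1`, and all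
other registers and cells are zero. -/
def inputState (l : List (ℤ × ℤ)) : State where
  reg r := if r = 0 then (l.length : ℤ) else 0
  mem a := if a % 2 = 0 then (l.getD (a / 2) (0, 0)).1 else (l.getD (a / 2) (0, 0)).2

/-- The largest absolute value of a number in the input: of the number of points and of their
coordinates. -/
def inputMagnitude (l : List (ℤ × ℤ)) : ℕ :=
  l.foldr (fun p m => max (max p.1.natAbs p.2.natAbs) m) l.length

end DoubleTurning

namespace DoubleTurning

/-! For a solid graph, a double turning Hamiltonian cycle exists if and only if there are at least
two vertices and, for one of the two chessboard colours, any two vertices are linked by a chain of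
pixels of that colour, consecutive ones sharing a corner (`hasDoubleTurningCycle_iff_reaches`).

Necessity. At a turn the square on the inner side of the walk stays the same, and the one on the
outer side jumps to the opposite square at the vertex (`Turns.squares`). So all squares on the left
have one colour, and all squares on the right have the other. Every edge is used once, so the
winding number about the left square exceeds that about the right one by 1. As one of the two
squares survives each turn, both winding numbers are constant along the walk (`left_const`). At an
edge of the lowest row one of them is 0; hence one side has winding number 0 throughout and the
other has 1 or -1 throughout. In a solid graph a square with nonzero winding number is a pixel
(`IsSolid.corner_mem`), because the winding number changes only across edges and vanishes far away.
So consecutive vertices of the walk are corners of pixels of one colour (`exists_tileAdj`).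

Sufficiency, which does not need solidity. Pixels of one colour share no edges. Start with the
4-cycle around one of them. Whenever the current cycle meets a corner of a new pixel of that colour,
splice in the 4-cycle around it, in the direction that makes both transitions turns
(`Tours.exists_insert`). A maximal set of pixels toured in this way touches everything reachable.

The algorithm is a breadth first search for each colour. Memory is zero initially, so a
direct-address table over a square containing all points answers membership in constant time without
being cleared. A vertex lies on just two squares of a given colour, so each vertex costs a bounded
number of steps. -/

/-! ### Turning cycles as periodic sequences -/

theorem squareLattice_adj_iff (p q : ℤ × ℤ) : squareLattice.Adj p q ↔
    (q.1 = p.1 + 1 ∧ q.2 = p.2) ∨ (q.1 = p.1 - 1 ∧ q.2 = p.2) ∨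
    (q.1 = p.1 ∧ q.2 = p.2 + 1) ∨ (q.1 = p.1 ∧ q.2 = p.2 - 1) := by
  change (p.1 - q.1) ^ 2 + (p.2 - q.2) ^ 2 = 1 ↔ _
  constructor
  · intro h
    have h1 : |p.1 - q.1| ≤ 1 := by
      rw [← sq_le_one_iff_abs_le_one]; nlinarith [sq_nonneg (p.2 - q.2)]
    have h2 : |p.2 - q.2| ≤ 1 := by
      rw [← sq_le_one_iff_abs_le_one]; nlinarith [sq_nonneg (p.1 - q.1)]
    rw [abs_le] at h1 h2
    obtain ⟨x, hx⟩ : ∃ x, p.1 - q.1 = x := ⟨_, rfl⟩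
    obtain ⟨y, hy⟩ : ∃ y, p.2 - q.2 = y := ⟨_, rfl⟩
    rw [hx] at h h1
    rw [hy] at h h2
    obtain ⟨a, b⟩ := h1
    obtain ⟨c, d⟩ := h2
    interval_cases x <;> interval_cases y <;> simp at h <;> omega
  · rintro (⟨h, h'⟩ | ⟨h, h'⟩ | ⟨h, h'⟩ | ⟨h, h'⟩) <;> rw [h, h'] <;> ring

/-- A closed lattice walk, unrolled to a periodic sequence of period `n`, that turns at every
vertex and uses no edge twice within a period. -/
structure IsTurningCycle (f : ℕ → ℤ × ℤ) (n : ℕ) : Prop where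
  pos : 0 < n
  periodic : ∀ i, f (i + n) = f i
  adj : ∀ i, squareLattice.Adj (f i) (f (i + 1))
  turns : ∀ i, Turns (f i) (f (i + 1)) (f (i + 2))
  edge_inj : ∀ i < n, ∀ j < n, s(f i, f (i + 1)) = s(f j, f (j + 1)) → i = j

namespace IsTurningCycle

variable {f : ℕ → ℤ × ℤ} {n : ℕ}

theorem apply_mod (h : IsTurningCycle f n) (i : ℕ) : f (i % n) = f i :=
  Function.Periodic.map_mod_nat h.periodic i

theorem apply_mod_add (h : IsTurningCycle f n) (i k : ℕ) : f (i % n + k) = f (i + k) := by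
  rw [← h.apply_mod, Nat.mod_add_mod, h.apply_mod]

end IsTurningCycle

theorem mod_apply_succ {f : ℕ → ℤ × ℤ} {n : ℕ} (hn : 0 < n) (h0 : f n = f 0) (i : ℕ) :
    f ((i + 1) % n) = f (i % n + 1) := by
  have := Nat.mod_lt i hn
  rw [Nat.add_mod]
  rcases Nat.lt_or_ge 1 n with h1 | h1
  · rw [Nat.mod_eq_of_lt h1]
    rcases Nat.lt_or_ge (i % n + 1) n with h | h
    · rw [Nat.mod_eq_of_lt h]
    · have : i % n + 1 = n := by omega
      rw [this, Nat.mod_self, h0]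
  · have : n = 1 := by omega
    subst this
    simp [Nat.mod_one, h0]

/-- The periodic continuation of one round of a turning cycle. -/
theorem IsTurningCycle.of_closed {f : ℕ → ℤ × ℤ} {n : ℕ} (hn : 0 < n) (h0 : f n = f 0)
    (hadj : ∀ i < n, squareLattice.Adj (f i) (f (i + 1)))
    (hturn : ∀ i, i + 1 < n → Turns (f i) (f (i + 1)) (f (i + 2)))
    (hlast : Turns (f (n - 1)) (f 0) (f 1))
    (hinj : ∀ i < n, ∀ j < n, s(f i, f (i + 1)) = s(f j, f (j + 1)) → i = j) :
    IsTurningCycle (fun i => f (i % n)) n where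
  pos := hn
  periodic i := by simp
  adj i := by
    simp only [mod_apply_succ hn h0]
    exact hadj _ (Nat.mod_lt i hn)
  turns i := by
    have := Nat.mod_lt i hn
    rcases Nat.lt_or_ge (i % n + 1) n with h | h
    · have e : (i + 1) % n = i % n + 1 := by
        rw [Nat.add_mod, Nat.mod_eq_of_lt (a := 1) (by omega), Nat.mod_eq_of_lt h]
      change Turns (f (i % n)) (f ((i + 1) % n)) (f ((i + 1 + 1) % n))
      rw [mod_apply_succ hn h0 (i + 1), e]
      exact hturn _ h
    · have e : (i + 1) % n = 0 := by
        have e1 : i % n + 1 = n := by omega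
        rw [← Nat.mod_add_mod, e1, Nat.mod_self]
      change Turns (f (i % n)) (f ((i + 1) % n)) (f ((i + 1 + 1) % n))
      rw [mod_apply_succ hn h0 (i + 1), e, show i % n = n - 1 by omega]
      exact hlast
  edge_inj i hi j hj h := by
    simp only [mod_apply_succ hn h0] at h
    rw [Nat.mod_eq_of_lt hi, Nat.mod_eq_of_lt hj] at h
    exact hinj i hi j hj h

theorem exists_walk_getVert {α : Type*} {G : SimpleGraph α} (f : ℕ → α)
    (hf : ∀ i, G.Adj (f i) (f (i + 1))) (n k : ℕ) (u v : α) (hu : f k = u) (hv : f (k + n) = v) :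
    ∃ w : G.Walk u v, w.length = n ∧ ∀ i ≤ n, w.getVert i = f (k + i) := by
  induction n generalizing k u with
  | zero =>
    have : u = v := by rw [← hu, ← hv]; rfl
    subst this
    exact ⟨.nil, rfl, fun i hi => by obtain rfl := Nat.le_zero.1 hi; simp [hu]⟩
  | succ n ih =>
    obtain ⟨w, hw, hw'⟩ := ih (k + 1) (f (k + 1)) rfl (by rw [← hv]; congr 1; omega)
    refine ⟨.cons (hu ▸ hf k) w, by simp [hw], fun i hi => ?_⟩
    cases i with
    | zero => simp [hu]
    | succ i =>
      rw [SimpleGraph.Walk.getVert_cons_succ, hw' i (by omega)]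
      congr 1
      omega

/-- Unrolling the closed walk periodically removes the special role of the base point: its turn
becomes an ordinary one, and changing the base is a shift of the index. -/
theorem hasDoubleTurningCycle_iff (V : Set (ℤ × ℤ)) : HasDoubleTurningCycle V ↔
    ∃ f n, IsTurningCycle f n ∧ ∀ v, v ∈ V ↔ ∃ i, f i = v := by
  constructor
  · rintro ⟨v, w, hw, hsupp, hturn⟩
    have hn : 0 < w.length := by
      rcases Nat.eq_zero_or_pos w.length with h | h
      · exact absurd (SimpleGraph.Walk.length_eq_zero_iff.1 h).eq_nil hw.ne_nil
      · exact h
    let f : ℕ → ℤ × ℤ := fun i => (w.getVert i : ℤ × ℤ)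
    have h0 : f w.length = f 0 := by simp [f]
    refine ⟨fun i => f (i % w.length), w.length, .of_closed hn h0 ?_ ?_ ?_ ?_, ?_⟩
    · intro i hi
      exact w.adj_getVert_succ hi
    · intro i hi
      have := hturn i (by omega)
      rwa [Nat.mod_eq_of_lt hi] at this
    · have := hturn (w.length - 1) (by omega)
      rw [Nat.sub_add_cancel hn, Nat.mod_self] at this
      simpa [f] using this
    · intro i hi j hj h
      have h1 : w.edges[i]'(by simpa using hi) = w.edges[j]'(by simpa using hj) := by
        rw [SimpleGraph.Walk.getElem_edges, SimpleGraph.Walk.getElem_edges]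
        apply Sym2.map.injective Subtype.val_injective
        simpa [f] using h
      exact (hw.isTrail.edges_nodup.getElem_inj_iff).1 h1
    · intro u
      constructor
      · intro hu
        obtain ⟨i, hi, hle⟩ := SimpleGraph.Walk.mem_support_iff_exists_getVert.1 (hsupp ⟨u, hu⟩)
        have hfi : f i = u := congrArg Subtype.val hi
        refine ⟨i, ?_⟩
        rcases hle.eq_or_lt with rfl | hlt
        · simpa [← h0] using hfi
        · simpa [Nat.mod_eq_of_lt hlt] using hfi
      · rintro ⟨i, rfl⟩
        exact (w.getVert _).2
  · rintro ⟨f, n, h, hV⟩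
    have hm : ∀ i, f i ∈ V := fun i => (hV _).2 ⟨i, rfl⟩
    let g : ℕ → V := fun i => ⟨f i, hm i⟩
    obtain ⟨w, hw, hw'⟩ := exists_walk_getVert (G := gridGraph V) g (fun i => h.adj i) n 0 (g 0)
      (g 0) rfl (Subtype.ext (h.periodic 0))
    simp only [zero_add] at hw'
    refine ⟨g 0, w, ⟨⟨?_⟩, ?_⟩, ?_, ?_⟩
    · rw [List.nodup_iff_injective_getElem]
      rintro ⟨i, hi⟩ ⟨j, hj⟩ hij
      simp only [SimpleGraph.Walk.length_edges, hw] at hi hj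
      simp only [SimpleGraph.Walk.getElem_edges] at hij
      rw [hw' i hi.le, hw' _ hi, hw' j hj.le, hw' _ hj] at hij
      have := h.edge_inj i hi j hj (by simpa [g] using congrArg (Sym2.map Subtype.val) hij)
      simpa using this
    · intro h1
      have := h.pos
      rw [h1] at hw
      simp at hw
      omega
    · rintro ⟨u, hu⟩
      obtain ⟨i, rfl⟩ := (hV u).1 hu
      rw [SimpleGraph.Walk.mem_support_iff_exists_getVert]
      have := Nat.mod_lt i h.pos
      refine ⟨i % n, ?_, by omega⟩
      rw [hw' _ this.le]
      exact Subtype.ext (h.apply_mod i)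
    · intro i hi
      rw [hw] at hi ⊢
      have := Nat.mod_lt (i + 1) h.pos
      rw [hw' i hi.le, hw' (i + 1) hi, hw' _ this]
      change Turns (f i) (f (i + 1)) (f ((i + 1) % n + 1))
      rw [h.apply_mod_add]
      exact h.turns i


/-! ### Pixels of one colour -/

/-- The lattice point `p` is a corner of the unit square with lower left corner `s`. -/
def Corner (s p : ℤ × ℤ) : Prop :=
  s.1 ≤ p.1 ∧ p.1 ≤ s.1 + 1 ∧ s.2 ≤ p.2 ∧ p.2 ≤ s.2 + 1

/-- The unit square with lower left corner `s` is a pixel on `V` of the colour `κ` in the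
chessboard colouring of the plane. -/
def Tile (V : Set (ℤ × ℤ)) (κ : ℤ) (s : ℤ × ℤ) : Prop :=
  (s.1 + s.2 + κ) % 2 = 1 ∧ ∀ p, Corner s p → p ∈ V

/-- Two points are corners of a common pixel of colour `κ`. -/
def TileAdj (V : Set (ℤ × ℤ)) (κ : ℤ) (v w : ℤ × ℤ) : Prop :=
  ∃ s, Tile V κ s ∧ Corner s v ∧ Corner s w

/-! ### Winding numbers -/

/-- How often the step from `p` to `q` crosses the ray from the unit square `(a, b)` to the east,
counted with sign. -/
def crossing (p q : ℤ × ℤ) (a b : ℤ) : ℤ :=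
  if a + 1 ≤ p.1 then (if b + 1 ≤ q.2 then 1 else 0) - (if b + 1 ≤ p.2 then 1 else 0) else 0

/-- The winding number of the first `n` steps of `f` about the unit square with lower left corner
`(a, b)`. -/
def wind (f : ℕ → ℤ × ℤ) (n : ℕ) (a b : ℤ) : ℤ :=
  ∑ i ∈ Finset.range n, crossing (f i) (f (i + 1)) a b

/-- How often the first `n` steps of `f` go from `p` to `q`, minus how often they go from `q`
to `p`. -/
def flow (f : ℕ → ℤ × ℤ) (n : ℕ) (p q : ℤ × ℤ) : ℤ :=
  ∑ i ∈ Finset.range n, ((if f i = p ∧ f (i + 1) = q then 1 else 0) -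
    (if f i = q ∧ f (i + 1) = p then 1 else 0))

theorem flow_swap (f : ℕ → ℤ × ℤ) (n : ℕ) (p q : ℤ × ℤ) : flow f n q p = -flow f n p q := by
  simp [flow]

theorem flow_eq_zero {f : ℕ → ℤ × ℤ} {p q : ℤ × ℤ} (n : ℕ)
    (h : (∀ i, f i ≠ p) ∨ ∀ i, f i ≠ q) : flow f n p q = 0 := by
  rcases h with h | h <;> simp [flow, h]

namespace IsTurningCycle

variable {f : ℕ → ℤ × ℤ} {n : ℕ}

theorem sum_step_sub (h : IsTurningCycle f n) (ψ : ℤ × ℤ → ℤ) :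
    ∑ i ∈ Finset.range n, (ψ (f (i + 1)) - ψ (f i)) = 0 := by
  rw [Finset.sum_range_sub (fun i => ψ (f i))]
  have := h.periodic 0
  rw [zero_add] at this
  simp [this]

theorem wind_sub_east (h : IsTurningCycle f n) (a b : ℤ) :
    wind f n (a - 1) b - wind f n a b = flow f n (a, b) (a, b + 1) := by
  rw [wind, wind, flow, ← Finset.sum_sub_distrib]
  refine Finset.sum_congr rfl fun i _ => ?_
  have := (squareLattice_adj_iff _ _).1 (h.adj i)
  simp only [crossing, Prod.ext_iff]
  rcases this with h | h | h | h <;> rw [h.1, h.2] <;> split_ifs <;> omega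

/-- The crossings of the two parallel rays differ by what enters or leaves the half-line from `(a +
1, b)` to the east vertically. A closed walk has zero net flow into this half-line, so the
difference is carried by the only horizontal edge at its end. The added telescoping sum expresses
this balance. -/
theorem wind_sub_south (h : IsTurningCycle f n) (a b : ℤ) :
    wind f n a b - wind f n a (b - 1) = flow f n (a, b) (a + 1, b) := by
  rw [← add_zero (_ - _),
    ← h.sum_step_sub (fun p => if a + 1 ≤ p.1 ∧ p.2 = b then 1 else 0),
    wind, wind, flow, ← Finset.sum_sub_distrib, ← Finset.sum_add_distrib]
  refine Finset.sum_congr rfl fun i _ => ?_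
  have := (squareLattice_adj_iff _ _).1 (h.adj i)
  simp only [crossing, Prod.ext_iff]
  rcases this with h | h | h | h <;> rw [h.1, h.2] <;> split_ifs <;> omega

/-- An undirected edge occurs once per period, so neither a second passage nor one in the opposite
direction can disturb the count. -/
theorem flow_step (h : IsTurningCycle f n) (i : ℕ) : flow f n (f i) (f (i + 1)) = 1 := by
  have hlt := Nat.mod_lt i h.pos
  have e0 := h.apply_mod i
  have e1 := h.apply_mod_add i 1
  rw [flow, Finset.sum_eq_single (i % n)]
  · have : f i ≠ f (i + 1) := (h.adj i).ne
    simp [e0, e1, this]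
  · intro j hj hne
    have key : s(f j, f (j + 1)) ≠ s(f i, f (i + 1)) := fun he =>
      hne (h.edge_inj j (Finset.mem_range.1 hj) _ hlt (by rw [he, e0, e1]))
    rw [ne_eq, Sym2.eq_iff, not_or] at key
    simp [key.1, key.2]
  · intro hn
    exact absurd (Finset.mem_range.2 hlt) hn

/-- The winding number vanishes far away. -/
theorem exists_wind_eq_zero (h : IsTurningCycle f n) :
    ∃ N : ℤ, ∀ a b, N ≤ |a| ∨ N ≤ |b| → wind f n a b = 0 := by
  obtain ⟨N, hN⟩ : ∃ N : ℤ, ∀ i ∈ Finset.range (n + 1), |(f i).1| + |(f i).2| ≤ N :=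
    ⟨_, fun i hi => Finset.single_le_sum (f := fun i => |(f i).1| + |(f i).2|)
      (fun i _ => by positivity) hi⟩
  have hN0 : 0 ≤ N := le_trans (by positivity) (hN 0 (by simp))
  have hb : ∀ i, i ≤ n → -N ≤ (f i).1 ∧ (f i).1 ≤ N ∧ -N ≤ (f i).2 ∧ (f i).2 ≤ N := by
    intro i hi
    have h1 := hN i (by simpa using Nat.lt_succ_of_le hi)
    have h2 := abs_le.1 (show |(f i).1| ≤ N by linarith [abs_nonneg (f i).2])
    have h3 := abs_le.1 (show |(f i).2| ≤ N by linarith [abs_nonneg (f i).1])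
    exact ⟨h2.1, h2.2, h3.1, h3.2⟩
  refine ⟨N + 2, fun a b hab => ?_⟩
  have hab' : N + 2 ≤ a ∨ a ≤ -(N + 2) ∨ N + 2 ≤ b ∨ b ≤ -(N + 2) := by
    rcases hab with h | h <;> rw [le_abs] at h <;> omega
  rcases hab' with ha | ha | hb' | hb'
  · refine Finset.sum_eq_zero fun i hi => ?_
    have := hb i (Finset.mem_range.1 hi).le
    rw [crossing, if_neg (by omega)]
  -- Far to the west every step lies on the side of the ray, so all changes of the height indicator
  -- are counted and they telescope to zero.
  · rw [← h.sum_step_sub (fun p => if b + 1 ≤ p.2 then 1 else 0)]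
    refine Finset.sum_congr rfl fun i hi => ?_
    have := hb i (Finset.mem_range.1 hi).le
    rw [crossing, if_pos (by omega)]
  all_goals
    refine Finset.sum_eq_zero fun i hi => ?_
    have h1 := hb i (Finset.mem_range.1 hi).le
    have h2 := hb (i + 1) (Finset.mem_range.1 hi)
    rw [crossing]
    split_ifs <;> omega

end IsTurningCycle

/-! ### Solidity -/

theorem exists_int_of_mem_drawing {V : Set (ℤ × ℤ)} {z : ℝ × ℝ} (hz : z ∈ drawing V) :
    (∃ m : ℤ, z.1 = m) ∨ ∃ m : ℤ, z.2 = m := by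
  rcases hz with ⟨p, -, rfl⟩ | ⟨p, -, q, -, hpq, a, b, ha, hb, hab, rfl⟩
  · exact .inl ⟨p.1, rfl⟩
  · have e : ∀ x : ℝ, a * x + b * x = x := fun x => by rw [← add_mul, hab, one_mul]
    rcases (squareLattice_adj_iff p q).1 hpq with ⟨-, h⟩ | ⟨-, h⟩ | ⟨h, -⟩ | ⟨h, -⟩
    · exact .inr ⟨p.2, by simp [toPlane, h, e]⟩
    · exact .inr ⟨p.2, by simp [toPlane, h, e]⟩
    · exact .inl ⟨p.1, by simp [toPlane, h, e]⟩
    · exact .inl ⟨p.1, by simp [toPlane, h, e]⟩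

/-- The floor can jump only at an integer, and only to the value below. This reduces continuity on a
face to comparing at most four squares. -/
theorem eventually_floor_eq (x : ℝ) :
    ∀ᶠ y in nhds x, ⌊y⌋ = ⌊x⌋ ∨ ((⌊x⌋ : ℝ) = x ∧ ⌊y⌋ = ⌊x⌋ - 1) := by
  have h1 := Int.floor_le x
  have h2 := Int.lt_floor_add_one x
  rcases h1.eq_or_lt with h | h
  · filter_upwards [Ioo_mem_nhds (show (⌊x⌋ : ℝ) - 1 < x by linarith) h2] with y hy
    rcases lt_or_ge y ⌊x⌋ with hlt | hge
    · exact .inr ⟨h, Int.floor_eq_iff.2 ⟨by push_cast; exact hy.1.le, by push_cast; linarith⟩⟩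
    · exact .inl (Int.floor_eq_iff.2 ⟨hge, hy.2⟩)
  · filter_upwards [Ioo_mem_nhds h h2] with y hy
    exact .inl (Int.floor_eq_iff.2 ⟨hy.1.le, hy.2⟩)

theorem mem_drawing_vertical {V : Set (ℤ × ℤ)} {z : ℝ × ℝ} (hx : (⌊z.1⌋ : ℝ) = z.1)
    (h1 : (⌊z.1⌋, ⌊z.2⌋) ∈ V) (h2 : (⌊z.1⌋, ⌊z.2⌋ + 1) ∈ V) : z ∈ drawing V := by
  refine .inr ⟨_, h1, _, h2, (squareLattice_adj_iff _ _).2 (by simp), ?_⟩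
  have h3 := Int.floor_le z.2
  have h4 := Int.lt_floor_add_one z.2
  refine ⟨⌊z.2⌋ + 1 - z.2, z.2 - ⌊z.2⌋, by linarith, by linarith, by ring, ?_⟩
  ext
  · simp only [toPlane, hx, Prod.fst_add, Prod.smul_fst, smul_eq_mul]; ring
  · simp only [toPlane, Prod.snd_add, Prod.smul_snd, smul_eq_mul]; push_cast; ring

theorem mem_drawing_horizontal {V : Set (ℤ × ℤ)} {z : ℝ × ℝ} (hy : (⌊z.2⌋ : ℝ) = z.2)
    (h1 : (⌊z.1⌋, ⌊z.2⌋) ∈ V) (h2 : (⌊z.1⌋ + 1, ⌊z.2⌋) ∈ V) : z ∈ drawing V := by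
  refine .inr ⟨_, h1, _, h2, (squareLattice_adj_iff _ _).2 (by simp), ?_⟩
  have h3 := Int.floor_le z.1
  have h4 := Int.lt_floor_add_one z.1
  refine ⟨⌊z.1⌋ + 1 - z.1, z.1 - ⌊z.1⌋, by linarith, by linarith, by ring, ?_⟩
  ext
  · simp only [toPlane, Prod.fst_add, Prod.smul_fst, smul_eq_mul]; push_cast; ring
  · simp only [toPlane, hy, Prod.snd_add, Prod.smul_snd, smul_eq_mul]; ring

/-- In a solid grid graph, a function on the unit squares that changes only across edges of the
graph, and vanishes far away, is supported on the pixels. -/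
theorem IsSolid.corner_mem {V : Set (ℤ × ℤ)} (hV : IsSolid V) (w : ℤ → ℤ → ℤ) (N : ℤ)
    (hx : ∀ a b, (a, b) ∉ V ∨ (a, b + 1) ∉ V → w (a - 1) b = w a b)
    (hy : ∀ a b, (a, b) ∉ V ∨ (a + 1, b) ∉ V → w a (b - 1) = w a b)
    (hN : ∀ a b, N ≤ |a| ∨ N ≤ |b| → w a b = 0)
    {s p : ℤ × ℤ} (hs : w s.1 s.2 ≠ 0) (hp : Corner s p) : p ∈ V := by
  obtain ⟨a, b⟩ := s
  set z₀ : ℝ × ℝ := ((a : ℝ) + 1 / 2, (b : ℝ) + 1 / 2) with hz₀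
  have hfl : ∀ c : ℤ, ⌊(c : ℝ) + 1 / 2⌋ = c := fun c =>
    Int.floor_eq_iff.2 ⟨by linarith, by linarith⟩
  have hz₀' : z₀ ∈ (drawing V)ᶜ := by
    intro h
    rcases exists_int_of_mem_drawing h with ⟨m, hm⟩ | ⟨m, hm⟩
    · have h1 := hfl a
      have h2 : (a : ℝ) + 1 / 2 = m := hm
      rw [h2, Int.floor_intCast] at h1
      rw [h1] at h2
      linarith
    · have h1 := hfl b
      have h2 : (b : ℝ) + 1 / 2 = m := hm
      rw [h2, Int.floor_intCast] at h1
      rw [h1] at h2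
      linarith
  have hmem : z₀ ∈ connectedComponentIn (drawing V)ᶜ z₀ := mem_connectedComponentIn hz₀'
  -- If the face of the centre `z₀` is bounded, solidity makes it the pixel of `s`. Otherwise `w`
  -- would be a nonzero constant on an unbounded face, against its vanishing far away.
  by_cases hbd : Bornology.IsBounded (connectedComponentIn (drawing V)ᶜ z₀)
  · obtain ⟨a', b', h1, h2, h3, h4, hF⟩ := hV _ ⟨z₀, hz₀', rfl⟩ hbd
    rw [hF] at hmem
    obtain ⟨⟨h5, h6⟩, h7, h8⟩ := hmem
    have ha : a = a' := by
      rw [← hfl a]; exact Int.floor_eq_iff.2 ⟨h5.le, h6⟩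
    have hb : b = b' := by
      rw [← hfl b]; exact Int.floor_eq_iff.2 ⟨h7.le, h8⟩
    subst ha hb
    obtain ⟨p1, p2⟩ := p
    simp only [Corner] at hp
    obtain rfl | rfl : p1 = a ∨ p1 = a + 1 := by omega
    all_goals obtain rfl | rfl : p2 = b ∨ p2 = b + 1 := by omega
    all_goals assumption
  · exfalso
    let g : ℝ × ℝ → ℤ := fun z => w ⌊z.1⌋ ⌊z.2⌋
    have hg : ContinuousOn g (connectedComponentIn (drawing V)ᶜ z₀) := by
      intro z hz
      have hzV : z ∉ drawing V := connectedComponentIn_subset _ _ hz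
      refine ContinuousAt.continuousWithinAt ?_
      refine (continuousAt_const (y := g z)).congr ?_
      have e1 := continuous_fst.continuousAt.eventually (eventually_floor_eq z.1)
      have e2 := continuous_snd.continuousAt.eventually (eventually_floor_eq z.2)
      have hvert : (⌊z.1⌋ : ℝ) = z.1 → w (⌊z.1⌋ - 1) ⌊z.2⌋ = w ⌊z.1⌋ ⌊z.2⌋ := fun h =>
        hx _ _ (by by_contra hc; push Not at hc; exact hzV (mem_drawing_vertical h hc.1 hc.2))
      have hhor : (⌊z.2⌋ : ℝ) = z.2 → w ⌊z.1⌋ (⌊z.2⌋ - 1) = w ⌊z.1⌋ ⌊z.2⌋ := fun h =>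
        hy _ _ (by by_contra hc; push Not at hc; exact hzV (mem_drawing_horizontal h hc.1 hc.2))
      filter_upwards [e1, e2] with y h1 h2
      rcases h1 with h1 | ⟨h1', h1⟩ <;> rcases h2 with h2 | ⟨h2', h2⟩ <;>
        simp only [g, h1, h2]
      · exact (hhor h2').symm
      · exact (hvert h1').symm
      -- At an absent lattice point all four incident edges are missing, so the diagonal square is
      -- reached through the one south of `z`.
      · have hout : (⌊z.1⌋, ⌊z.2⌋) ∉ V := fun hc =>
          hzV (.inl ⟨_, hc, Prod.ext h1' h2'⟩)
        rw [hx ⌊z.1⌋ (⌊z.2⌋ - 1) (.inr (by simpa using hout)), hhor h2']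
    apply hbd
    refine (Metric.isBounded_closedBall (x := (0 : ℝ × ℝ)) (r := |(N : ℝ)| + 2)).subset ?_
    intro z hz
    have hc : g z = g z₀ :=
      isPreconnected_connectedComponentIn.constant hg hz hmem
    have hgz : g z ≠ 0 := by
      rw [hc]
      simpa only [g, hz₀, hfl] using hs
    have hlt : |⌊z.1⌋| < N ∧ |⌊z.2⌋| < N := by
      by_contra hcon
      exact hgz (hN _ _ (by rw [not_and_or, not_lt, not_lt] at hcon; exact hcon))
    have key : ∀ x : ℝ, |⌊x⌋| < N → |x| ≤ |(N : ℝ)| + 2 := by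
      intro x hx
      have h1 := Int.floor_le x
      have h2 := Int.lt_floor_add_one x
      have h3 : |(⌊x⌋ : ℝ)| < N := by exact_mod_cast hx
      have h4 := le_abs_self (N : ℝ)
      rw [abs_lt] at h3
      rw [abs_le]
      constructor <;> linarith
    rw [mem_closedBall_zero_iff, Prod.norm_def]
    exact max_le (key _ hlt.1) (key _ hlt.2)


/-! ### Necessity: the two sides of a turning cycle -/

/-- The lower left corner of the unit square to the left of the step from `p` to `q`. -/
def leftSquare (p q : ℤ × ℤ) : ℤ × ℤ :=
  (p.1 + (q.1 - p.1 - (q.2 - p.2) - 1) / 2, p.2 + (q.1 - p.1 + (q.2 - p.2) - 1) / 2)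

/-- The lower left corner of the unit square to the right of the step from `p` to `q`. -/
def rightSquare (p q : ℤ × ℤ) : ℤ × ℤ :=
  (p.1 + (q.1 - p.1 + (q.2 - p.2) - 1) / 2, p.2 + (q.2 - p.2 - (q.1 - p.1) - 1) / 2)

theorem corner_leftSquare {p q : ℤ × ℤ} (h : squareLattice.Adj p q) :
    Corner (leftSquare p q) p ∧ Corner (leftSquare p q) q := by
  rcases (squareLattice_adj_iff p q).1 h with h | h | h | h <;>
    simp only [Corner, leftSquare, h.1, h.2] <;> omega

theorem corner_rightSquare {p q : ℤ × ℤ} (h : squareLattice.Adj p q) :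
    Corner (rightSquare p q) p ∧ Corner (rightSquare p q) q := by
  rcases (squareLattice_adj_iff p q).1 h with h | h | h | h <;>
    simp only [Corner, rightSquare, h.1, h.2] <;> omega

theorem rightSquare_parity {p q : ℤ × ℤ} (h : squareLattice.Adj p q) :
    ((rightSquare p q).1 + (rightSquare p q).2) % 2 =
      ((leftSquare p q).1 + (leftSquare p q).2 + 1) % 2 := by
  rcases (squareLattice_adj_iff p q).1 h with h | h | h | h <;>
    simp only [leftSquare, rightSquare, h.1, h.2] <;> omega

/-- In a turn, the square on the inner side is kept, and the one on the outer side is replaced by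
the opposite one at the vertex. -/
theorem Turns.squares {p q r : ℤ × ℤ} (h1 : squareLattice.Adj p q) (h2 : squareLattice.Adj q r)
    (h : Turns p q r) :
    ((leftSquare p q).1 + (leftSquare p q).2) % 2 =
      ((leftSquare q r).1 + (leftSquare q r).2) % 2 ∧
    (leftSquare p q = leftSquare q r ∨ rightSquare p q = rightSquare q r) := by
  simp only [Turns] at h
  rcases (squareLattice_adj_iff p q).1 h1 with h1 | h1 | h1 | h1 <;>
  rcases (squareLattice_adj_iff q r).1 h2 with h2 | h2 | h2 | h2 <;>
    simp only [leftSquare, rightSquare, h1.1, h1.2, h2.1, h2.2, Prod.ext_iff] at h ⊢ <;>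
    ring_nf at h <;> omega

theorem TileAdj.symm {V : Set (ℤ × ℤ)} {κ : ℤ} {v w : ℤ × ℤ} (h : TileAdj V κ v w) :
    TileAdj V κ w v :=
  let ⟨s, hs, hv, hw⟩ := h
  ⟨s, hs, hw, hv⟩

namespace IsTurningCycle

variable {f : ℕ → ℤ × ℤ} {n : ℕ}

theorem wind_sub_of_adj (h : IsTurningCycle f n) {p q : ℤ × ℤ} (hpq : squareLattice.Adj p q) :
    wind f n (leftSquare p q).1 (leftSquare p q).2 -
      wind f n (rightSquare p q).1 (rightSquare p q).2 = flow f n p q := by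
  obtain ⟨a, b⟩ := p
  obtain ⟨c, d⟩ := q
  rcases (squareLattice_adj_iff _ _).1 hpq with h' | h' | h' | h' <;> dsimp only at h' <;>
    obtain ⟨rfl, rfl⟩ := h' <;> simp only [leftSquare, rightSquare]
  · rw [← h.wind_sub_south]
    congr 2 <;> omega
  · rw [flow_swap, show flow f n (a - 1, d) (a, d) = flow f n (a - 1, d) (a - 1 + 1, d) by simp,
      ← h.wind_sub_south, neg_sub]
    congr 2 <;> omega
  · rw [← h.wind_sub_east]
    congr 2 <;> omega
  · rw [flow_swap, show flow f n (c, b - 1) (c, b) = flow f n (c, b - 1) (c, b - 1 + 1) by simp,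
      ← h.wind_sub_east, neg_sub]
    congr 2 <;> omega

theorem wind_left_sub_right (h : IsTurningCycle f n) (i : ℕ) :
    wind f n (leftSquare (f i) (f (i + 1))).1 (leftSquare (f i) (f (i + 1))).2 -
      wind f n (rightSquare (f i) (f (i + 1))).1 (rightSquare (f i) (f (i + 1))).2 = 1 := by
  rw [h.wind_sub_of_adj (h.adj i), h.flow_step]

/-- The winding number on the left is the same all along the cycle, and so is the colour. -/
theorem left_const (h : IsTurningCycle f n) (i : ℕ) :
    wind f n (leftSquare (f i) (f (i + 1))).1 (leftSquare (f i) (f (i + 1))).2 =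
      wind f n (leftSquare (f 0) (f 1)).1 (leftSquare (f 0) (f 1)).2 ∧
    ((leftSquare (f i) (f (i + 1))).1 + (leftSquare (f i) (f (i + 1))).2) % 2 =
      ((leftSquare (f 0) (f 1)).1 + (leftSquare (f 0) (f 1)).2) % 2 := by
  induction i with
  | zero => simp
  | succ i ih =>
    obtain ⟨hc, hs⟩ := (h.turns i).squares (h.adj i) (h.adj (i + 1))
    have h1 := h.wind_left_sub_right i
    have h2 := h.wind_left_sub_right (i + 1)
    refine ⟨?_, hc.symm.trans ih.2⟩
    rw [← ih.1]
    -- If the left square survives the turn there is nothing to do; if the right one does, the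
    -- constant difference 1 transfers the equality to the left.
    rcases hs with hs | hs
    · rw [hs]
    · rw [hs] at h1
      linarith

/-- One of the two squares at a step along the lowest row is not encircled. -/
theorem exists_wind_eq_zero_of_step (h : IsTurningCycle f n) :
    ∃ i, wind f n (leftSquare (f i) (f (i + 1))).1 (leftSquare (f i) (f (i + 1))).2 = 0 ∨
      wind f n (rightSquare (f i) (f (i + 1))).1 (rightSquare (f i) (f (i + 1))).2 = 0 := by
  obtain ⟨m, -, hm⟩ := Finset.exists_min_image (Finset.range n) (fun i => (f i).2)
    ⟨0, Finset.mem_range.2 h.pos⟩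
  have hmin : ∀ j, (f m).2 ≤ (f j).2 := fun j => by
    rw [← h.apply_mod j]
    exact hm _ (Finset.mem_range.2 (Nat.mod_lt _ h.pos))
  -- A ray below the lowest row has both ends of every step above it, so no step crosses it.
  have hlow : ∀ a, wind f n a ((f m).2 - 1) = 0 := fun a => by
    refine Finset.sum_eq_zero fun i _ => ?_
    rw [crossing, sub_add_cancel, if_pos (hmin i), if_pos (hmin (i + 1))]
    simp
  have hflat : ∀ k, (f k).2 = (f m).2 → (f (k + 1)).2 = (f m).2 →
      (leftSquare (f k) (f (k + 1))).2 = (f m).2 - 1 ∨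
        (rightSquare (f k) (f (k + 1))).2 = (f m).2 - 1 := fun k h1 h2 => by
    have := (squareLattice_adj_iff _ _).1 (h.adj k)
    simp only [leftSquare, rightSquare, h1, h2] at this ⊢
    omega
  have hflat' : ∀ k, (f k).2 = (f m).2 → (f (k + 1)).2 = (f m).2 →
      wind f n (leftSquare (f k) (f (k + 1))).1 (leftSquare (f k) (f (k + 1))).2 = 0 ∨
      wind f n (rightSquare (f k) (f (k + 1))).1 (rightSquare (f k) (f (k + 1))).2 = 0 :=
    fun k h1 h2 => (hflat k h1 h2).imp (fun e => by rw [e, hlow]) (fun e => by rw [e, hlow])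
  -- The index `m + (n - 1)` is the predecessor of `m` modulo the period. At the lowest vertex `f m`
  -- the walk turns, so the step into it or the step out of it is horizontal.
  have e1 : f (m + (n - 1) + 1) = f m := by
    rw [add_assoc, Nat.sub_add_cancel h.pos, h.periodic]
  have ht := h.turns (m + (n - 1))
  have a1 := (squareLattice_adj_iff _ _).1 (h.adj (m + (n - 1)))
  have a2 := (squareLattice_adj_iff _ _).1 (h.adj (m + (n - 1) + 1))
  by_cases hh : (f (m + (n - 1))).2 = (f m).2
  · exact ⟨_, hflat' _ hh (by rw [e1])⟩
  · refine ⟨m + (n - 1) + 1, hflat' _ (by rw [e1]) ?_⟩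
    rw [e1] at a1 a2
    rw [Turns, e1] at ht
    rcases a1 with a1 | a1 | a1 | a1
    · exact absurd a1.2.symm hh
    · exact absurd a1.2.symm hh
    all_goals
      rw [a1.1, a1.2] at ht
      ring_nf at ht
      have := a1.2
      ring_nf at *
      omega

/-- Winding number 0 on the left forces -1 on the right, and 0 on the right forces 1 on the left.
The side with nonzero value consists of pixels, and its parity determines `κ`. -/
theorem exists_tileAdj (h : IsTurningCycle f n) {V : Set (ℤ × ℤ)} (hV : IsSolid V)
    (hf : ∀ i, f i ∈ V) : ∃ κ : ℤ, (κ = 0 ∨ κ = 1) ∧ ∀ i, TileAdj V κ (f i) (f (i + 1)) := by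
  obtain ⟨N, hN⟩ := h.exists_wind_eq_zero
  have hout : ∀ p, p ∉ V → ∀ i, f i ≠ p := fun p hp i hi => hp (hi ▸ hf i)
  have hcorner : ∀ s p : ℤ × ℤ, wind f n s.1 s.2 ≠ 0 → Corner s p → p ∈ V := fun s p hs hp => by
    refine hV.corner_mem (wind f n) N (fun a b hab => ?_) (fun a b hab => ?_) hN hs hp
    · rw [← sub_eq_zero, h.wind_sub_east, flow_eq_zero]
      exact hab.imp (hout _) (hout _)
    · rw [eq_comm, ← sub_eq_zero, h.wind_sub_south, flow_eq_zero]
      exact hab.imp (hout _) (hout _)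
  obtain ⟨k, hk⟩ := h.exists_wind_eq_zero_of_step
  have hl := h.left_const
  have hk1 := (hl k).1
  have hk2 := h.wind_left_sub_right k
  set s₀ := leftSquare (f 0) (f 1)
  rcases hk with hk | hk
  · refine ⟨(s₀.1 + s₀.2) % 2, by omega, fun i => ⟨rightSquare (f i) (f (i + 1)), ⟨?_, fun p => ?_⟩,
      corner_rightSquare (h.adj i)⟩⟩
    · have h1 := rightSquare_parity (h.adj i)
      have h2 := (hl i).2
      omega
    · refine hcorner _ _ ?_
      have h1 := h.wind_left_sub_right i
      have h2 := (hl i).1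
      omega
  · refine ⟨(s₀.1 + s₀.2 + 1) % 2, by omega, fun i => ⟨leftSquare (f i) (f (i + 1)),
      ⟨?_, fun p => ?_⟩, corner_leftSquare (h.adj i)⟩⟩
    · have h2 := (hl i).2
      omega
    · refine hcorner _ _ ?_
      have h2 := (hl i).1
      omega

end IsTurningCycle

theorem HasDoubleTurningCycle.exists_reachable {V : Set (ℤ × ℤ)} (hV : IsSolid V)
    (h : HasDoubleTurningCycle V) : V.Nontrivial ∧ ∃ κ : ℤ, (κ = 0 ∨ κ = 1) ∧
      ∀ v ∈ V, ∀ w ∈ V, Relation.ReflTransGen (TileAdj V κ) v w := by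
  obtain ⟨f, n, hf, hfV⟩ := (hasDoubleTurningCycle_iff V).1 h
  have hm : ∀ i, f i ∈ V := fun i => (hfV _).2 ⟨i, rfl⟩
  obtain ⟨κ, hκ, hadj⟩ := hf.exists_tileAdj hV hm
  refine ⟨⟨f 0, hm 0, f 1, hm 1, (hf.adj 0).ne⟩, κ, hκ, fun v hv w hw => ?_⟩
  have hreach : ∀ i, Relation.ReflTransGen (TileAdj V κ) (f 0) (f i) := fun i => by
    induction i with
    | zero => exact .refl
    | succ i ih => exact ih.tail (hadj i)
  have : Std.Symm (TileAdj V κ) := ⟨fun _ _ => TileAdj.symm⟩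
  obtain ⟨i, rfl⟩ := (hfV v).1 hv
  obtain ⟨j, rfl⟩ := (hfV w).1 hw
  exact (Relation.ReflTransGen.stdSymm.symm _ _ (hreach i)).trans (hreach j)


/-! ### Sufficiency: splicing 4-cycles -/

/-- A square is determined by one of its edges and its colour. -/
theorem corner_unique {s t p q : ℤ × ℤ} (hadj : squareLattice.Adj p q)
    (hc : (s.1 + s.2) % 2 = (t.1 + t.2) % 2) (hp : Corner s p) (hq : Corner s q)
    (hp' : Corner t p) (hq' : Corner t q) : s = t := by
  simp only [Corner] at *
  rw [Prod.ext_iff]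
  rcases (squareLattice_adj_iff p q).1 hadj with h | h | h | h <;> omega

/-- The sequence that runs through `v, a, o, c` and then through `f`. -/
def splice (v a o c : ℤ × ℤ) (f : ℕ → ℤ × ℤ) : ℕ → ℤ × ℤ
  | 0 => v
  | 1 => a
  | 2 => o
  | 3 => c
  | i + 4 => f i

/-- Insertion of a 4-cycle at the base point of a turning cycle. -/
theorem IsTurningCycle.splice {f : ℕ → ℤ × ℤ} {n : ℕ} (h : IsTurningCycle f n)
    {v a o c : ℤ × ℤ} (hv : f 0 = v)
    (h1 : squareLattice.Adj v a) (h2 : squareLattice.Adj a o) (h3 : squareLattice.Adj o c)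
    (h4 : squareLattice.Adj c v) (t1 : Turns v a o) (t2 : Turns a o c) (t3 : Turns o c v)
    (t4 : Turns c v (f 1)) (t5 : Turns (f (n - 1)) v a) (hvo : v ≠ o) (hac : a ≠ c)
    (hd : ∀ i, s(f i, f (i + 1)) ∉ ({s(v, a), s(a, o), s(o, c), s(c, v)} : Set (Sym2 (ℤ × ℤ)))) :
    IsTurningCycle (fun i => DoubleTurning.splice v a o c f (i % (n + 4))) (n + 4) := by
  have hn := h.pos
  obtain ⟨m, rfl⟩ : ∃ m, n = m + 1 := ⟨n - 1, by omega⟩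
  have hfn : f (m + 1) = v := by simpa [hv] using h.periodic 0
  refine .of_closed (by omega) hfn ?_ ?_ ?_ ?_
  · rintro (_ | _ | _ | _ | i) hi
    · exact h1
    · exact h2
    · exact h3
    · change squareLattice.Adj c (f 0)
      rwa [hv]
    · exact h.adj i
  · rintro (_ | _ | _ | _ | i) hi
    · exact t1
    · exact t2
    · change Turns o c (f 0)
      rwa [hv]
    · change Turns c (f 0) (f 1)
      rwa [hv]
    · exact h.turns i
  · exact t5
  · simp only [Set.mem_insert_iff, Set.mem_singleton_iff, not_or] at hd
    have ne1 := h1.ne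
    have ne2 := h2.ne
    have ne3 := h3.ne
    have ne4 := h4.ne
    rintro (_ | _ | _ | _ | i) hi (_ | _ | _ | _ | j) hj hij <;>
      simp only [DoubleTurning.splice, hv, Nat.add_right_cancel_iff] at hij ⊢
    case succ.succ.succ.succ.succ.succ.succ.succ =>
      exact h.edge_inj i (by omega) j (by omega) hij
    all_goals first
      | exact absurd hij (hd _).1
      | exact absurd hij (hd _).2.1
      | exact absurd hij (hd _).2.2.1
      | exact absurd hij (hd _).2.2.2
      | exact absurd hij.symm (hd _).1
      | exact absurd hij.symm (hd _).2.1
      | exact absurd hij.symm (hd _).2.2.1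
      | exact absurd hij.symm (hd _).2.2.2
      | (exfalso; simp only [Sym2.eq_iff] at hij; grind)

theorem IsTurningCycle.rotate {f : ℕ → ℤ × ℤ} {n : ℕ} (h : IsTurningCycle f n) (k : ℕ) :
    IsTurningCycle (fun i => f (i + k)) n where
  pos := h.pos
  periodic i := by rw [Nat.add_right_comm, h.periodic]
  adj i := by rw [Nat.add_right_comm]; exact h.adj _
  turns i := by rw [Nat.add_right_comm i 1, Nat.add_right_comm i 2]; exact h.turns _
  edge_inj i hi j hj hij := by
    have key : (i + k) % n = (j + k) % n := by
      refine h.edge_inj _ (Nat.mod_lt _ h.pos) _ (Nat.mod_lt _ h.pos) ?_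
      rw [h.apply_mod, h.apply_mod, h.apply_mod_add, h.apply_mod_add, Nat.add_right_comm,
        Nat.add_right_comm j]
      exact hij
    have := Nat.ModEq.add_right_cancel' k key
    rwa [Nat.ModEq, Nat.mod_eq_of_lt hi, Nat.mod_eq_of_lt hj] at this

/-- A turning cycle that runs along sides of the squares in `S` and visits all their corners. -/
structure Tours (f : ℕ → ℤ × ℤ) (n : ℕ) (S : Set (ℤ × ℤ)) : Prop where
  cycle : IsTurningCycle f n
  edge : ∀ i, ∃ s ∈ S, Corner s (f i) ∧ Corner s (f (i + 1))
  vertex : ∀ s ∈ S, ∀ p, Corner s p → ∃ i, f i = p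

/-- An edge of the old cycle that was also a side of `q` would belong to a square of `S` of the same
colour, which `corner_unique` identifies with `q`. Hence the new 4-cycle is edge-disjoint from the
old cycle. -/
theorem Tours.splice {f : ℕ → ℤ × ℤ} {n : ℕ} {S : Set (ℤ × ℤ)} {κ : ℤ} (h : Tours f n S)
    (hS : ∀ s ∈ S, (s.1 + s.2 + κ) % 2 = 1) {q v a o c : ℤ × ℤ}
    (hq : (q.1 + q.2 + κ) % 2 = 1) (hqS : q ∉ S) (hv : f 0 = v)
    (h1 : squareLattice.Adj v a) (h2 : squareLattice.Adj a o) (h3 : squareLattice.Adj o c)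
    (h4 : squareLattice.Adj c v) (t1 : Turns v a o) (t2 : Turns a o c) (t3 : Turns o c v)
    (t4 : Turns c v (f 1)) (t5 : Turns (f (n - 1)) v a) (hvo : v ≠ o) (hac : a ≠ c)
    (hcorner : ∀ p, Corner q p ↔ p = v ∨ p = a ∨ p = o ∨ p = c) :
    Tours (fun i => DoubleTurning.splice v a o c f (i % (n + 4))) (n + 4) (insert q S) where
  cycle := by
    refine h.cycle.splice hv h1 h2 h3 h4 t1 t2 t3 t4 t5 hvo hac fun i hi => ?_
    obtain ⟨s, hs, hs1, hs2⟩ := h.edge i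
    have hqq : Corner q (f i) ∧ Corner q (f (i + 1)) := by
      simp only [Set.mem_insert_iff, Set.mem_singleton_iff, Sym2.eq_iff] at hi
      rw [hcorner, hcorner]
      grind
    have := hS s hs
    exact hqS (corner_unique (h.cycle.adj i) (by omega) hs1 hs2 hqq.1 hqq.2 ▸ hs)
  edge i := by
    have hfn : f n = v := by simpa [hv] using h.cycle.periodic 0
    have hlt := Nat.mod_lt i (show 0 < n + 4 by omega)
    simp only [mod_apply_succ (f := DoubleTurning.splice v a o c f) (show 0 < n + 4 by omega) hfn]
    generalize i % (n + 4) = r at hlt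
    match r with
    | 0 | 1 | 2 => exact ⟨q, .inl rfl, by simp [hcorner, DoubleTurning.splice]⟩
    | 3 => exact ⟨q, .inl rfl, by simp [hcorner, DoubleTurning.splice, hv]⟩
    | j + 4 =>
      obtain ⟨s, hs, h⟩ := h.edge j
      exact ⟨s, .inr hs, h⟩
  vertex s hs p hp := by
    have small : ∀ j, j < n + 4 → DoubleTurning.splice v a o c f j = p →
        ∃ i, DoubleTurning.splice v a o c f (i % (n + 4)) = p := fun j hj h =>
      ⟨j, by rwa [Nat.mod_eq_of_lt hj]⟩
    rcases hs with rfl | hs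
    · rcases (hcorner p).1 hp with rfl | rfl | rfl | rfl
      exacts [small 0 (by omega) rfl, small 1 (by omega) rfl, small 2 (by omega) rfl,
        small 3 (by omega) rfl]
    · obtain ⟨i, hi⟩ := h.vertex s hs p hp
      refine small (i % n + 4) (by have := Nat.mod_lt i h.cycle.pos; omega) ?_
      exact (h.cycle.apply_mod i).trans hi

theorem corner_iff_reflect {q v : ℤ × ℤ} (hv : Corner q v) (p : ℤ × ℤ) : Corner q p ↔
    p = v ∨ p = (2 * q.1 + 1 - v.1, v.2) ∨ p = (2 * q.1 + 1 - v.1, 2 * q.2 + 1 - v.2) ∨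
      p = (v.1, 2 * q.2 + 1 - v.2) := by
  simp only [Corner, Prod.ext_iff] at *
  omega

/-- At the common vertex one of the two old edges is horizontal and the other vertical. The 4-cycle
is run so that it starts perpendicular to the incoming edge; it then ends perpendicular to the
outgoing one, as its own two edges at the vertex are perpendicular. -/
theorem Tours.exists_insert {f : ℕ → ℤ × ℤ} {n : ℕ} {S : Set (ℤ × ℤ)} {κ : ℤ} (h : Tours f n S)
    (hS : ∀ s ∈ S, (s.1 + s.2 + κ) % 2 = 1) {q : ℤ × ℤ} (hq : (q.1 + q.2 + κ) % 2 = 1)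
    (hqS : q ∉ S) {k : ℕ} (hv : Corner q (f k)) : ∃ g m, Tours g m (insert q S) := by
  wlog hk : k = 0 generalizing f k
  · refine this (f := fun i => f (i + k)) (k := 0) ⟨h.cycle.rotate k, fun i => ?_, ?_⟩ ?_ rfl
    · have := h.edge (i + k)
      rwa [Nat.add_right_comm] at this
    · intro s hs p hp
      obtain ⟨i, hi⟩ := h.vertex s hs p hp
      -- The multiple `n * k` of the period keeps the natural subtraction from truncating.
      refine ⟨i + n * k - k, ?_⟩
      have : k ≤ n * k := Nat.le_mul_of_pos_left k h.cycle.pos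
      rw [Nat.sub_add_cancel (by omega), ← h.cycle.apply_mod, Nat.add_mul_mod_self_left,
        h.cycle.apply_mod, hi]
    · simpa using hv
  subst hk
  have hn := h.cycle.pos
  have hlast := h.cycle.adj (n - 1)
  have ht := h.cycle.turns (n - 1)
  have hp0 := h.cycle.periodic 0
  have hp1 := h.cycle.periodic 1
  rw [show n - 1 + 2 = 1 + n by omega, hp1] at ht
  rw [Nat.sub_add_cancel hn] at hlast ht
  rw [zero_add] at hp0
  rw [hp0] at hlast ht
  have hfirst := h.cycle.adj 0
  rw [zero_add] at hfirst
  have hcor := corner_iff_reflect hv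
  generalize hv0 : f 0 = v at *
  rw [squareLattice_adj_iff] at hlast hfirst
  have hv' := hv
  simp only [Corner] at hv'
  simp only [Turns] at ht
  by_cases hh : (f (n - 1)).2 = v.2
  · have hf1 : (f 1).1 = v.1 := by
      rw [hh, sub_self, zero_mul, add_zero, mul_eq_zero] at ht
      omega
    refine ⟨_, _, h.splice hS hq hqS hv0 (a := (v.1, 2 * q.2 + 1 - v.2))
      (o := (2 * q.1 + 1 - v.1, 2 * q.2 + 1 - v.2)) (c := (2 * q.1 + 1 - v.1, v.2))
      ?_ ?_ ?_ ?_ ?_ ?_ ?_ ?_ ?_ ?_ ?_ fun p => (hcor p).trans (by tauto)⟩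
    iterate 4 rw [squareLattice_adj_iff]; clear ht; dsimp only; omega
    all_goals simp only [Turns, ne_eq, Prod.ext_iff, hf1, hh]
    all_goals first | ring1 | (clear ht; omega)
  · have hl1 : (f (n - 1)).1 = v.1 := by omega
    have hf1 : (f 1).2 = v.2 := by
      rw [hl1, sub_self, zero_mul, zero_add, mul_eq_zero] at ht
      omega
    refine ⟨_, _, h.splice hS hq hqS hv0 (a := (2 * q.1 + 1 - v.1, v.2))
      (o := (2 * q.1 + 1 - v.1, 2 * q.2 + 1 - v.2)) (c := (v.1, 2 * q.2 + 1 - v.2))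
      ?_ ?_ ?_ ?_ ?_ ?_ ?_ ?_ ?_ ?_ ?_ hcor⟩
    iterate 4 rw [squareLattice_adj_iff]; clear ht; dsimp only; omega
    all_goals simp only [Turns, ne_eq, Prod.ext_iff, hf1, hl1]
    all_goals first | ring1 | (clear ht; omega)

/-- The 4-cycle around a square. -/
theorem exists_tours_singleton (q : ℤ × ℤ) : ∃ f n, Tours f n {q} := by
  let f : ℕ → ℤ × ℤ
    | 0 => q
    | 1 => (q.1 + 1, q.2)
    | 2 => (q.1 + 1, q.2 + 1)
    | 3 => (q.1, q.2 + 1)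
    | _ + 4 => q
  have hc : ∀ i, Corner q (f i) := by
    rintro (_ | _ | _ | _ | i) <;> simp [f, Corner]
  refine ⟨_, 4, .of_closed (f := f) (by omega) rfl ?_ ?_ ?_ ?_, fun i => ⟨q, rfl, hc _, hc _⟩, ?_⟩
  · intro i hi
    rw [squareLattice_adj_iff]
    interval_cases i <;> simp [f]
  · intro i hi
    have : i < 3 := by omega
    interval_cases i <;> simp [f, Turns]
  · simp [f, Turns]
  · intro i hi j hj
    interval_cases i <;> interval_cases j <;> simp [f, Prod.ext_iff]
  · rintro s rfl p hp
    have h4 : p = f 0 ∨ p = f 1 ∨ p = f 2 ∨ p = f 3 := by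
      simp only [f, Corner, Prod.ext_iff] at *
      omega
    rcases h4 with h | h | h | h
    exacts [⟨0, h.symm⟩, ⟨1, h.symm⟩, ⟨2, h.symm⟩, ⟨3, h.symm⟩]

/-- A maximal toured set of pixels contains every pixel of the colour that touches its tour, so the
vertices of the tour are closed under `TileAdj`. Nontriviality of `V` provides the first pixel; a
single vertex is vacuously connected but has no cycle. -/
theorem hasDoubleTurningCycle_of_reachable {V : Set (ℤ × ℤ)} (hfin : V.Finite)
    (hnt : V.Nontrivial) {κ : ℤ} {v₀ : ℤ × ℤ}
    (h : ∀ w ∈ V, Relation.ReflTransGen (TileAdj V κ) v₀ w) : HasDoubleTurningCycle V := by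
  obtain ⟨w, hw, hne⟩ := hnt.exists_ne v₀
  obtain ⟨q, hq, hqv⟩ : ∃ q, Tile V κ q ∧ Corner q v₀ := by
    rcases (h w hw).cases_head with e | ⟨u, ⟨q, hq, hqv, -⟩, -⟩
    · exact absurd e.symm hne
    · exact ⟨q, hq, hqv⟩
  let T : Set (ℤ × ℤ) := {s | Tile V κ s}
  have hT : T.Finite := hfin.subset fun s hs => hs.2 s (by simp [Corner])
  let P : Set (Set (ℤ × ℤ)) := {S | S ⊆ T ∧ q ∈ S ∧ ∃ f n, Tours f n S}
  have hP : P.Finite := hT.finite_subsets.subset fun S hS => hS.1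
  obtain ⟨S, ⟨hST, hqS, f, n, hf⟩, hmax⟩ := hP.exists_maximal
    ⟨{q}, Set.singleton_subset_iff.2 hq, rfl, exists_tours_singleton q⟩
  have hstep : ∀ i u, TileAdj V κ (f i) u → ∃ j, f j = u := by
    rintro i u ⟨s, hs, hs1, hs2⟩
    have hsS : s ∈ S := by
      by_contra hc
      refine hc (hmax ⟨Set.insert_subset hs hST, .inr hqS, ?_⟩ (Set.subset_insert s S) (.inl rfl))
      exact hf.exists_insert (fun s hs => (hST hs).1) hs.1 hc hs1
    exact hf.vertex s hsS u hs2
  rw [hasDoubleTurningCycle_iff]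
  refine ⟨f, n, hf.cycle, fun v => ⟨fun hv => ?_, ?_⟩⟩
  · have hr := h v hv
    clear hv
    induction hr with
    | refl => exact hf.vertex q hqS v₀ hqv
    | tail _ hbc ih =>
      obtain ⟨i, rfl⟩ := ih
      exact hstep i _ hbc
  · rintro ⟨i, rfl⟩
    obtain ⟨s, hs, hs1, -⟩ := hf.edge i
    exact (hST hs).2 _ hs1


/-! ### Total correctness with time bounds -/

theorem State.setReg_reg (σ : State) (d : ℕ) (z : ℤ) (r : ℕ) :
    (σ.setReg d z).reg r = if r = d then z else σ.reg r :=
  Function.update_apply ..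

@[simp] theorem State.setReg_mem (σ : State) (d : ℕ) (z : ℤ) : (σ.setReg d z).mem = σ.mem := rfl

@[simp] theorem State.setMem_reg (σ : State) (a : ℕ) (z : ℤ) : (σ.setMem a z).reg = σ.reg := rfl

theorem State.setMem_mem (σ : State) (a : ℕ) (z : ℤ) (c : ℕ) :
    (σ.setMem a z).mem c = if c = a then z else σ.mem c :=
  Function.update_apply ..

/-- Started in `σ`, the program `P` halts within `T` steps in a state that satisfies `Q`. -/
def Terminates (B : ℕ) (P : Prog) (T : ℕ) (σ : State) (Q : State → Prop) : Prop :=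
  ∃ t τ, Exec B P σ t τ ∧ t ≤ T ∧ Q τ

namespace Terminates

variable {B T T₁ T₂ : ℕ} {p q : Prog} {σ : State} {Q Q' : State → Prop} {b : Test}

theorem mono (h : Terminates B p T₁ σ Q') (hT : T₁ ≤ T) (hQ : ∀ τ, Q' τ → Q τ) :
    Terminates B p T σ Q :=
  let ⟨t, τ, he, ht, hq⟩ := h
  ⟨t, τ, he, ht.trans hT, hQ τ hq⟩

theorem skip (h : Q σ) : Terminates B .skip (T + 1) σ Q :=
  ⟨1, σ, .skip σ, by omega, h⟩

theorem const {d : ℕ} {z : ℤ} (hz : -(B : ℤ) ≤ z ∧ z ≤ B) (h : Q (σ.setReg d z)) :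
    Terminates B (.const d z) (T + 1) σ Q :=
  ⟨1, _, .const σ d z (abs_le.2 hz), by omega, h⟩

theorem op {o : BinOp} {d a c : ℕ} (z : ℤ) (he : o.eval (σ.reg a) (σ.reg c) = z)
    (hz : -(B : ℤ) ≤ z ∧ z ≤ B) (h : Q (σ.setReg d z)) : Terminates B (.op o d a c) (T + 1) σ Q := by
  subst he
  exact ⟨1, _, .op σ o d a c (abs_le.2 hz), by omega, h⟩

theorem load {d a : ℕ} (c : ℕ) (z : ℤ) (hc : σ.reg a = c) (hz : σ.mem c = z)
    (h : Q (σ.setReg d z)) : Terminates B (.load d a) (T + 1) σ Q := by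
  subst hz
  have e : (σ.reg a).toNat = c := by omega
  have := Exec.load (B := B) σ d a (by omega)
  rw [e] at this
  exact ⟨1, _, this, by omega, h⟩

theorem store {a s : ℕ} (c : ℕ) (z : ℤ) (hc : σ.reg a = c) (hz : σ.reg s = z)
    (h : Q (σ.setMem c z)) : Terminates B (.store a s) (T + 1) σ Q := by
  subst hz
  have e : (σ.reg a).toNat = c := by omega
  have := Exec.store (B := B) σ a s (by omega)
  rw [e] at this
  exact ⟨1, _, this, by omega, h⟩

theorem seq (hp : Terminates B p T₁ σ fun τ => Terminates B q T₂ τ Q) :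
    Terminates B (.seq p q) (T₁ + T₂) σ Q := by
  obtain ⟨t₁, τ₁, e₁, h₁, t₂, τ₂, e₂, h₂, h⟩ := hp
  exact ⟨_, _, .seq e₁ e₂, by omega, h⟩

theorem ite (h₁ : b.Holds σ → Terminates B p T σ Q) (h₂ : ¬b.Holds σ → Terminates B q T σ Q) :
    Terminates B (.ite b p q) (T + 1) σ Q := by
  by_cases hb : b.Holds σ
  · obtain ⟨t, τ, e, ht, h⟩ := h₁ hb
    exact ⟨_, _, .iteTrue hb e, by omega, h⟩
  · obtain ⟨t, τ, e, ht, h⟩ := h₂ hb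
    exact ⟨_, _, .iteFalse hb e, by omega, h⟩

/-- A loop whose invariant `I k` admits at most `k` further rounds. -/
theorem loop (I : ℕ → State → Prop) {k : ℕ} (hI : I k σ)
    (step : ∀ k σ, I k σ → b.Holds σ → ∃ j, k = j + 1 ∧ Terminates B p T σ (I j))
    (hQ : ∀ k σ, I k σ → ¬b.Holds σ → Q σ) :
    Terminates B (.loop b p) ((T + 1) * k + 1) σ Q := by
  induction k generalizing σ with
  | zero =>
    have hb : ¬b.Holds σ := fun hb => by
      obtain ⟨j, hj, -⟩ := step _ _ hI hb
      omega
    exact ⟨1, σ, .loopDone hb, by omega, hQ _ _ hI hb⟩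
  | succ k ih =>
    by_cases hb : b.Holds σ
    · obtain ⟨j, hj, t, τ, e, ht, h⟩ := step _ _ hI hb
      obtain rfl : k = j := by omega
      obtain ⟨t', τ', e', ht', h'⟩ := ih h
      refine ⟨_, _, .loopStep hb e e', ?_, h'⟩
      rw [Nat.mul_succ]
      omega
    · exact ⟨1, σ, .loopDone hb, by omega, hQ _ _ hI hb⟩

theorem const_seq {d : ℕ} {z : ℤ} (hz : -(B : ℤ) ≤ z ∧ z ≤ B)
    (h : Terminates B q T (σ.setReg d z) Q) :
    Terminates B (.seq (.const d z) q) (T + 1) σ Q := by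
  rw [add_comm]
  exact (const (T := 0) hz h).seq

theorem op_seq {o : BinOp} {d a c : ℕ} (z : ℤ) (he : o.eval (σ.reg a) (σ.reg c) = z)
    (hz : -(B : ℤ) ≤ z ∧ z ≤ B) (h : Terminates B q T (σ.setReg d z) Q) :
    Terminates B (.seq (.op o d a c) q) (T + 1) σ Q := by
  rw [add_comm]
  exact (op (T := 0) z he hz h).seq

theorem load_seq {d a : ℕ} (c : ℕ) (z : ℤ) (hc : σ.reg a = c) (hz : σ.mem c = z)
    (h : Terminates B q T (σ.setReg d z) Q) :
    Terminates B (.seq (.load d a) q) (T + 1) σ Q := by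
  rw [add_comm]
  exact (load (T := 0) c z hc hz h).seq

theorem store_seq {a s : ℕ} (c : ℕ) (z : ℤ) (hc : σ.reg a = c) (hz : σ.reg s = z)
    (h : Terminates B q T (σ.setMem c z) Q) :
    Terminates B (.seq (.store a s) q) (T + 1) σ Q := by
  rw [add_comm]
  exact (store (T := 0) c z hc hz h).seq

end Terminates

/-! ### The program -/

local infixr:67 " ;; " => Prog.seq

/-- Reads the input once, to find a number `R` (register `3`) that exceeds the number of points and
all coordinates, and prepares the constants: `1`, `2`, the row width `2 * R + 1` of the vertex
table, its square, and the length of the input in the registers `1`, `2`, `4`, `5`, `6`. -/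
def setupProg : Prog :=
  .const 1 1 ;; .op .add 3 0 1 ;; .op .add 6 0 0 ;;
  .loop (.lt 10 6)
    (.load 16 10 ;; .op .mul 16 16 16 ;; .op .add 3 3 16 ;; .op .add 10 10 1) ;;
  .op .add 4 3 3 ;; .op .add 4 4 1 ;; .op .mul 5 4 4

/-- Marks all vertices in the table as present and unvisited. -/
def initProg : Prog :=
  .const 10 0 ;;
  .loop (.lt 10 6)
    (.load 16 10 ;; .op .add 10 10 1 ;; .load 17 10 ;; .op .add 10 10 1 ;;
      .op .mul 17 17 4 ;; .op .add 16 16 17 ;; .op .add 16 16 5 ;; .store 16 1)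

/-- Appends the vertex whose table address is in register `b` to the queue, unless visited. -/
def pushProg (b : ℕ) : Prog :=
  .load 16 b ;; .ite (.eq 16 1) (.store b 2 ;; .store 11 b ;; .op .add 11 11 1) .skip

/-- Appends to the queue the corners of the square whose lower left corner has its table address in
register `14`, if it is a pixel. -/
def visitProg : Prog :=
  .op .add 15 14 1 ;; .op .add 17 14 4 ;; .op .add 18 17 1 ;;
  .load 19 14 ;; .load 20 15 ;; .load 21 17 ;; .load 22 18 ;;
  .op .mul 19 19 20 ;; .op .mul 19 19 21 ;; .op .mul 19 19 22 ;;
  .ite (.eq 19 9) .skip (pushProg 14 ;; pushProg 15 ;; pushProg 17 ;; pushProg 18)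

/-- Takes a vertex from the queue and visits the two squares at it that have the colour in
register `7`. -/
def expandProg : Prog :=
  .load 12 10 ;; .op .add 10 10 1 ;;
  .op .add 13 12 7 ;; .op .div 17 13 2 ;; .op .mul 17 17 2 ;; .op .sub 13 13 17 ;;
  .op .sub 14 12 13 ;; visitProg ;;
  .op .sub 14 12 4 ;; .op .sub 14 14 1 ;; .op .add 14 14 13 ;; visitProg

/-- Breadth first search from the first vertex; sets register `8` to one if it reaches all
vertices. -/
def searchProg : Prog :=
  .load 16 9 ;; .load 17 1 ;; .op .mul 17 17 4 ;; .op .add 16 16 17 ;; .op .add 16 16 5 ;;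
  .store 16 2 ;; .store 6 16 ;; .op .add 10 6 9 ;; .op .add 11 6 1 ;;
  .loop (.lt 10 11) expandProg ;;
  .op .sub 16 11 6 ;; .ite (.eq 16 0) (.const 8 1) .skip

/-- The decision procedure. -/
def mainProg : Prog :=
  .const 2 2 ;;
  .ite (.lt 0 2) (.const 0 0)
    (setupProg ;; initProg ;; searchProg ;; .const 7 1 ;; initProg ;; searchProg ;; .op .add 0 8 9)

/-! ### The vertex table -/

/-- The address of the table cell for the lattice point `p`. -/
def addr (R : ℤ) (p : ℤ × ℤ) : ℤ := (2 * R + 1) ^ 2 + p.1 + (2 * R + 1) * p.2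

/-- The lattice point `p` has a cell in the table. -/
def InRange (R : ℤ) (p : ℤ × ℤ) : Prop := -R ≤ p.1 ∧ p.1 ≤ R ∧ -R ≤ p.2 ∧ p.2 ≤ R

/-- With `R` above the number of points, this places the table after the input and the queue, which
together fill the first `3 * l.length` cells. -/
theorem InRange.le_addr {R : ℤ} {p : ℤ × ℤ} (h : InRange R p) : 2 * R ^ 2 + 2 * R + 1 ≤ addr R p := by
  obtain ⟨h1, h2, h3, h4⟩ := h
  unfold addr
  nlinarith

theorem InRange.addr_le {R : ℤ} {p : ℤ × ℤ} (h : InRange R p) :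
    addr R p ≤ 2 * (2 * R + 1) ^ 2 := by
  obtain ⟨h1, h2, h3, h4⟩ := h
  unfold addr
  nlinarith

/-- First coordinates differ by at most `2 * R`, less than the row width `2 * R + 1`. -/
theorem InRange.addr_inj {R : ℤ} {p q : ℤ × ℤ} (hp : InRange R p) (hq : InRange R q)
    (h : addr R p = addr R q) : p = q := by
  obtain ⟨h1, h2, h3, h4⟩ := hp
  obtain ⟨h1', h2', h3', h4'⟩ := hq
  unfold addr at h
  have e : p.2 = q.2 := by
    rcases lt_trichotomy p.2 q.2 with hlt | he | hlt
    · nlinarith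
    · exact he
    · nlinarith
  rw [e] at h
  exact Prod.ext (by linarith) e

/-- The quantities of a run: input list `l`, table parameter `R`, word bound `B`. -/
structure Setting (B : ℕ) (l : List (ℤ × ℤ)) (R : ℤ) : Prop where
  two_le : 2 ≤ l.length
  nodup : l.Nodup
  length_lt : (l.length : ℤ) < R
  coord : ∀ p ∈ l, -R < p.1 ∧ p.1 < R ∧ -R < p.2 ∧ p.2 < R
  bound : 4 * (2 * R + 1) ^ 2 ≤ (B : ℤ)

/-- The registers and cells that a pass does not change. -/
structure Base (l : List (ℤ × ℤ)) (R κ ans : ℤ) (σ : State) : Prop where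
  reg0 : σ.reg 0 = l.length
  reg1 : σ.reg 1 = 1
  reg2 : σ.reg 2 = 2
  reg4 : σ.reg 4 = 2 * R + 1
  reg5 : σ.reg 5 = (2 * R + 1) ^ 2
  reg6 : σ.reg 6 = 2 * l.length
  reg7 : σ.reg 7 = κ
  reg8 : σ.reg 8 = ans
  reg9 : σ.reg 9 = 0
  input : ∀ (j : ℕ) (h : j < l.length), σ.mem (2 * j) = l[j].1 ∧ σ.mem (2 * j + 1) = l[j].2

theorem Base.congr {l : List (ℤ × ℤ)} {R κ ans : ℤ} {σ τ : State} (h : Base l R κ ans σ)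
    (hr : ∀ r < 10, τ.reg r = σ.reg r) (hm : ∀ a < 2 * l.length, τ.mem a = σ.mem a) :
    Base l R κ ans τ where
  reg0 := (hr 0 (by omega)).trans h.reg0
  reg1 := (hr 1 (by omega)).trans h.reg1
  reg2 := (hr 2 (by omega)).trans h.reg2
  reg4 := (hr 4 (by omega)).trans h.reg4
  reg5 := (hr 5 (by omega)).trans h.reg5
  reg6 := (hr 6 (by omega)).trans h.reg6
  reg7 := (hr 7 (by omega)).trans h.reg7
  reg8 := (hr 8 (by omega)).trans h.reg8
  reg9 := (hr 9 (by omega)).trans h.reg9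
  input j hj := by
    rw [hm _ (by omega), hm _ (by omega)]
    exact h.input j hj

open Classical in
/-- The table marks the vertices, and the visited ones, which are those on the queue `Q`. -/
structure Search (l : List (ℤ × ℤ)) (R κ ans : ℤ) (Q : List (ℤ × ℤ)) (σ : State) : Prop
    extends Base l R κ ans σ where
  tail : σ.reg 11 = 2 * l.length + Q.length
  table : ∀ p, InRange R p →
    σ.mem (addr R p).toNat = if p ∈ Q then 2 else if p ∈ l then 1 else 0
  queue : ∀ (j : ℕ) (h : j < Q.length), σ.mem (2 * l.length + j) = addr R Q[j]
  nodup : Q.Nodup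
  subset : Q ⊆ l

/-! ### Correctness of one search -/

section
variable {B : ℕ} {l : List (ℤ × ℤ)} {R κ ans : ℤ}

theorem Setting.inRange (hs : Setting B l R) {p : ℤ × ℤ} (hp : p ∈ l) : InRange R p := by
  have := hs.coord p hp
  unfold InRange
  omega

theorem Setting.addr_ge (hs : Setting B l R) {p : ℤ × ℤ} (hp : InRange R p) :
    3 * l.length ≤ (addr R p).toNat := by
  have h1 := hp.le_addr
  have h2 := hs.length_lt
  have h3 : 3 * (l.length : ℤ) ≤ addr R p := by nlinarith
  omega

theorem Setting.addr_toNat (hs : Setting B l R) {p : ℤ × ℤ} (hp : InRange R p) :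
    ((addr R p).toNat : ℤ) = addr R p := by
  have h1 := hs.addr_ge hp
  have h2 := hs.two_le
  omega

theorem Setting.addr_bound (hs : Setting B l R) {p : ℤ × ℤ} (hp : InRange R p) :
    0 ≤ addr R p ∧ addr R p + 2 * (2 * R + 1) ^ 2 ≤ B := by
  have h1 := hs.addr_toNat hp
  have h2 := hp.addr_le
  have h3 := hs.bound
  constructor <;> linarith [Int.natCast_nonneg (addr R p).toNat]

theorem Setting.toNat_inj (hs : Setting B l R) {p q : ℤ × ℤ} (hp : InRange R p) (hq : InRange R q) :
    (addr R p).toNat = (addr R q).toNat ↔ p = q := by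
  refine ⟨fun h => hp.addr_inj hq ?_, fun h => by rw [h]⟩
  rw [← hs.addr_toNat hp, h, hs.addr_toNat hq]

theorem Setting.width (hs : Setting B l R) : 3 ≤ R ∧ 2 * R + 1 ≤ (2 * R + 1) ^ 2 ∧ 196 ≤ (B : ℤ) := by
  have h1 := hs.length_lt
  have h2 := hs.two_le
  have h3 := hs.bound
  have h4 : 3 ≤ R := by omega
  refine ⟨h4, ?_, ?_⟩ <;> nlinarith

theorem Search.congr {Q : List (ℤ × ℤ)} {σ τ : State} (h : Search l R κ ans Q σ)
    (hr : ∀ r < 12, r ≠ 10 → τ.reg r = σ.reg r) (hm : τ.mem = σ.mem) : Search l R κ ans Q τ :=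
  { h.toBase.congr (fun r hr' => hr r (by omega) (by omega)) (fun a _ => by rw [hm]) with
    tail := (hr 11 (by omega) (by omega)).trans h.tail
    table := by rw [hm]; exact h.table
    queue := by rw [hm]; exact h.queue
    nodup := h.nodup
    subset := h.subset }

/-- The mark 1 means present and unvisited; setting it to 2 keeps the queue free of repetitions. -/
theorem Search.push (hs : Setting B l R) {Q : List (ℤ × ℤ)} {σ : State}
    (h : Search l R κ ans Q σ) {p : ℤ × ℤ} (hp : InRange R p) {b : ℕ} (hb : b ≠ 16)
    (hσ : σ.reg b = addr R p) :
    Terminates B (pushProg b) 5 σ fun τ => ∃ Q', Search l R κ ans Q' τ ∧ Q <+: Q' ∧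
      (∀ x ∈ Q', x ∈ Q ∨ x = p) ∧ (p ∈ l → p ∈ Q') ∧
      ∀ r, r ≠ 11 → r ≠ 16 → τ.reg r = σ.reg r := by
  have hage := hs.addr_ge hp
  have hato := hs.addr_toNat hp
  refine .load_seq _ _ (hσ.trans hato.symm) (h.table p hp) ?_
  refine .ite (fun hc => ?_) fun hc => ?_
  · have hpl : p ∉ Q ∧ p ∈ l := by
      simp only [Test.Holds, State.setReg_reg, if_true, OfNat.one_ne_ofNat, if_false, h.reg1] at hc
      split_ifs at hc with h1 h2
      · omega
      · exact ⟨h1, h2⟩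
      · omega
    -- A repetition-free queue inside `l` that misses `p` leaves room for one more entry, so the
    -- write stays below the table.
    have hlen : Q.length < l.length := by
      have := (List.nodup_cons.2 ⟨hpl.1, h.nodup⟩).subperm
        (List.cons_subset.2 ⟨hpl.2, h.subset⟩) |>.length_le
      simpa using this
    have hQ := h.tail
    refine .store_seq (addr R p).toNat 2 ?_ ?_ ?_
    · simp [State.setReg_reg, hb, hσ, hato]
    · simp [State.setReg_reg, h.reg2]
    refine .store_seq (2 * l.length + Q.length) (addr R p) ?_ ?_ ?_
    · simp [State.setReg_reg, hQ]
    · simp [State.setReg_reg, hb, hσ]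
    refine .op (2 * l.length + Q.length + 1) ?_ ?_ ?_
    · simp [State.setReg_reg, hQ, h.reg1, BinOp.eval]
    · have := hs.addr_bound hp
      have := sq_nonneg (2 * R + 1)
      constructor <;> omega
    refine ⟨Q ++ [p], ?_, by simp, by simp, by simp, ?_⟩
    · refine { h.toBase.congr ?_ ?_ with
        tail := ?_, table := ?_, queue := ?_, nodup := ?_, subset := ?_ }
      · intro r hr
        simp [State.setReg_reg, show r ≠ 11 by omega, show r ≠ 16 by omega]
      · intro a ha
        simp [State.setMem_mem, show a ≠ 2 * l.length + Q.length by omega,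
          show a ≠ (addr R p).toNat by omega]
      · simp [State.setReg_reg]
        ring
      · intro x hx
        have hage' := hs.addr_ge hx
        simp only [State.setReg_mem, State.setMem_mem, hs.toNat_inj hx hp,
          show (addr R x).toNat ≠ 2 * l.length + Q.length by omega, if_false, h.table x hx,
          List.mem_append, List.mem_singleton]
        by_cases hxp : x = p <;> simp [hxp]
      · intro j hj
        rw [List.length_append, List.length_singleton] at hj
        simp only [State.setReg_mem, State.setMem_mem]
        rcases Nat.lt_or_ge j Q.length with hlt | hge
        · rw [if_neg (by omega), if_neg (by omega), h.queue j hlt, List.getElem_append_left hlt]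
        · obtain rfl : j = Q.length := by omega
          simp
      · rw [List.nodup_append]
        exact ⟨h.nodup, by simp, fun x hx y hy e => hpl.1 (by
          rwa [← List.mem_singleton.1 hy, ← e])⟩
      · exact List.append_subset.2 ⟨h.subset, by simpa using hpl.2⟩
    · intro r hr hr'
      simp [State.setReg_reg, hr, hr']
  · refine (Terminates.skip (T := 2) ?_)
    refine ⟨Q, ?_, List.prefix_refl Q, fun x hx => .inl hx, fun hpl => ?_, ?_⟩
    · exact h.congr (fun r hr _ => by rw [State.setReg_reg, if_neg (by omega)]) rfl
    · by_contra hpQ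
      exact hc (by simp [Test.Holds, State.setReg_reg, h.reg1, hpQ, hpl])
    · intro r hr hr'
      simp [State.setReg_reg, hr']


theorem corner_iff (s p : ℤ × ℤ) : Corner s p ↔
    p = s ∨ p = (s.1 + 1, s.2) ∨ p = (s.1, s.2 + 1) ∨ p = (s.1 + 1, s.2 + 1) := by
  simp only [Corner, Prod.ext_iff]
  omega

theorem mul_mul_mul_bounds {a b c d : ℤ} (ha : 0 ≤ a ∧ a ≤ 2) (hb : 0 ≤ b ∧ b ≤ 2)
    (hc : 0 ≤ c ∧ c ≤ 2) (hd : 0 ≤ d ∧ d ≤ 2) :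
    (0 ≤ a * b ∧ a * b ≤ 4) ∧ (0 ≤ a * b * c ∧ a * b * c ≤ 8) ∧
      (0 ≤ a * b * c * d ∧ a * b * c * d ≤ 16) := by
  obtain ⟨a1, a2⟩ := ha
  obtain ⟨b1, b2⟩ := hb
  obtain ⟨c1, c2⟩ := hc
  obtain ⟨d1, d2⟩ := hd
  have h1 : 0 ≤ a * b := by positivity
  have h2 : a * b ≤ 2 * 2 := mul_le_mul a2 b2 b1 (by norm_num)
  have h3 : 0 ≤ a * b * c := by positivity
  have h4 : a * b * c ≤ 2 * 2 * 2 := mul_le_mul h2 c2 c1 (by norm_num)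
  have h5 : 0 ≤ a * b * c * d := by positivity
  have h6 : a * b * c * d ≤ 2 * 2 * 2 * 2 := mul_le_mul h4 d2 d1 (by norm_num)
  exact ⟨⟨h1, h2⟩, ⟨h3, h4⟩, h5, h6⟩

/-- The marks are 0, 1 or 2, so their product over the four corners is nonzero exactly for a pixel.
This single test replaces four, and the product is at most 16. -/
theorem Search.visit (hs : Setting B l R) {Q : List (ℤ × ℤ)} {σ : State}
    (h : Search l R κ ans Q σ) {s : ℤ × ℤ} (hr : ∀ p, Corner s p → InRange R p)
    (hσ : σ.reg 14 = addr R s) :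
    Terminates B visitProg 31 σ fun τ => ∃ Q', Search l R κ ans Q' τ ∧ Q <+: Q' ∧
      (∀ x ∈ Q', x ∈ Q ∨ Corner s x ∧ ∀ p, Corner s p → p ∈ l) ∧
      ((∀ p, Corner s p → p ∈ l) → ∀ p, Corner s p → p ∈ Q') ∧
      ∀ r < 14, r ≠ 11 → τ.reg r = σ.reg r := by
  classical
  simp only [corner_iff, forall_eq_or_imp, forall_eq] at hr
  obtain ⟨hr0, hr1, hr2, hr3⟩ := hr
  have e1 : addr R (s.1 + 1, s.2) = addr R s + 1 := by simp only [addr]; ring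
  have e2 : addr R (s.1, s.2 + 1) = addr R s + (2 * R + 1) := by simp only [addr]; ring
  have e3 : addr R (s.1 + 1, s.2 + 1) = addr R s + (2 * R + 1) + 1 := by simp only [addr]; ring
  have ⟨w1, w2, w3⟩ := hs.width
  have b0 := hs.addr_bound hr0
  have hmark : ∀ p, InRange R p → ∃ z : ℤ, σ.mem (addr R p).toNat = z ∧ (0 ≤ z ∧ z ≤ 2) ∧
      (z = 0 ↔ p ∉ l) := fun p hp => by
    refine ⟨_, h.table p hp, ?_, ?_⟩
    · split_ifs <;> norm_num
    · split_ifs with h1 h2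
      · simpa using h.subset h1
      · simpa using h2
      · simpa using h2
  obtain ⟨z0, hz0, bz0, iz0⟩ := hmark _ hr0
  obtain ⟨z1, hz1, bz1, iz1⟩ := hmark _ hr1
  obtain ⟨z2, hz2, bz2, iz2⟩ := hmark _ hr2
  obtain ⟨z3, hz3, bz3, iz3⟩ := hmark _ hr3
  have hz := mul_mul_mul_bounds bz0 bz1 bz2 bz3
  refine .op_seq (addr R s + 1) (by simp [BinOp.eval, hσ, h.reg1]) (by constructor <;> omega) ?_
  refine .op_seq (addr R s + (2 * R + 1)) (by simp [State.setReg_reg, BinOp.eval, hσ, h.reg4])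
    (by constructor <;> omega) ?_
  refine .op_seq (addr R s + (2 * R + 1) + 1) (by simp [State.setReg_reg, BinOp.eval, h.reg1])
    (by constructor <;> omega) ?_
  refine .load_seq _ z0 (by simp [State.setReg_reg, hσ, hs.addr_toNat hr0]) hz0 ?_
  refine .load_seq _ z1 (by rw [hs.addr_toNat hr1, e1]; simp [State.setReg_reg]) hz1 ?_
  refine .load_seq _ z2 (by rw [hs.addr_toNat hr2, e2]; simp [State.setReg_reg]) hz2 ?_
  refine .load_seq _ z3 (by rw [hs.addr_toNat hr3, e3]; simp [State.setReg_reg]) hz3 ?_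
  refine .op_seq (z0 * z1) (by simp [State.setReg_reg, BinOp.eval]) (by constructor <;> omega) ?_
  refine .op_seq (z0 * z1 * z2) (by simp [State.setReg_reg, BinOp.eval])
    (by constructor <;> omega) ?_
  refine .op_seq (z0 * z1 * z2 * z3) (by simp [State.setReg_reg, BinOp.eval])
    (by constructor <;> omega) ?_
  set σ₁ := State.setReg _ 19 (z0 * z1 * z2 * z3) with hσ₁
  have hreg : ∀ r, r < 15 ∨ r = 16 → σ₁.reg r = σ.reg r := fun r hr => by
    simp only [hσ₁, State.setReg_reg]
    repeat rw [if_neg (by omega)]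
  have h₁ : Search l R κ ans Q σ₁ := h.congr (fun r hr _ => hreg r (by omega)) rfl
  have g14 : σ₁.reg 14 = addr R s := by rw [hreg _ (by omega), hσ]
  have g15 : σ₁.reg 15 = addr R (s.1 + 1, s.2) := by rw [e1]; simp [hσ₁, State.setReg_reg]
  have g17 : σ₁.reg 17 = addr R (s.1, s.2 + 1) := by rw [e2]; simp [hσ₁, State.setReg_reg]
  have g18 : σ₁.reg 18 = addr R (s.1 + 1, s.2 + 1) := by rw [e3]; simp [hσ₁, State.setReg_reg]
  have g19 : σ₁.reg 19 = z0 * z1 * z2 * z3 := by simp [hσ₁, State.setReg_reg]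
  have hall : z0 * z1 * z2 * z3 ≠ 0 ↔ ∀ p, Corner s p → p ∈ l := by
    simp only [corner_iff, forall_eq_or_imp, forall_eq, ne_eq, mul_eq_zero, iz0, iz1, iz2, iz3]
    tauto
  clear_value σ₁
  refine .ite (fun hc => ?_) fun hc => ?_
  · simp only [Test.Holds, g19, h₁.reg9] at hc
    refine .skip ⟨Q, h₁, List.prefix_refl Q, fun x hx => .inl hx, fun ha => ?_, fun r hr _ =>
      hreg r (by omega)⟩
    exact absurd hc (hall.2 ha)
  · simp only [Test.Holds, g19, h₁.reg9] at hc
    have ha := hall.1 hc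
    refine .seq (T₁ := 5) (T₂ := 15) ((h₁.push hs hr0 (by omega) g14).mono le_rfl ?_)
    rintro τ₁ ⟨Q₁, h₁', p₁, m₁, c₁, f₁⟩
    refine .seq (T₁ := 5) (T₂ := 10) ((h₁'.push hs hr1 (b := 15) (by omega)
      (by rw [f₁ _ (by omega) (by omega), g15])).mono le_rfl ?_)
    rintro τ₂ ⟨Q₂, h₂, p₂, m₂, c₂, f₂⟩
    refine .seq (T₁ := 5) (T₂ := 5) ((h₂.push hs hr2 (b := 17) (by omega)
      (by rw [f₂ _ (by omega) (by omega), f₁ _ (by omega) (by omega), g17])).mono le_rfl ?_)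
    rintro τ₃ ⟨Q₃, h₃, p₃, m₃, c₃, f₃⟩
    refine ((h₃.push hs hr3 (b := 18) (by omega) (by rw [f₃ _ (by omega) (by omega),
      f₂ _ (by omega) (by omega), f₁ _ (by omega) (by omega), g18])).mono le_rfl ?_)
    rintro τ₄ ⟨Q₄, h₄, p₄, m₄, c₄, f₄⟩
    refine ⟨Q₄, h₄, p₁.trans (p₂.trans (p₃.trans p₄)), fun x hx => ?_, fun _ => ?_,
      fun r hr hr' => ?_⟩
    · rw [corner_iff]
      rcases m₄ x hx with hx | hx
      · rcases m₃ x hx with hx | hx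
        · rcases m₂ x hx with hx | hx
          · rcases m₁ x hx with hx | hx
            · exact .inl hx
            · exact .inr ⟨.inl hx, ha⟩
          · exact .inr ⟨.inr (.inl hx), ha⟩
        · exact .inr ⟨.inr (.inr (.inl hx)), ha⟩
      · exact .inr ⟨.inr (.inr (.inr hx)), ha⟩
    · simp only [corner_iff, forall_eq_or_imp, forall_eq] at ha ⊢
      exact ⟨p₄.subset (p₃.subset (p₂.subset (c₁ ha.1))), p₄.subset (p₃.subset (c₂ ha.2.1)),
        p₄.subset (c₃ ha.2.2.1), c₄ ha.2.2.2⟩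
    · rw [f₄ r hr' (by omega), f₃ r hr' (by omega), f₂ r hr' (by omega), f₁ r hr' (by omega),
        hreg r (by omega)]

/-- The row width is odd, so the machine can read the chessboard colour at a vertex off its table
address without recovering the coordinates. -/
theorem addr_emod_two (R : ℤ) (p : ℤ × ℤ) : addr R p % 2 = (1 + p.1 + p.2) % 2 := by
  have : addr R p = (1 + p.1 + p.2) + 2 * (2 * R ^ 2 + 2 * R + R * p.2) := by
    simp only [addr]; ring
  rw [this, Int.add_mul_emod_self_left]

/-- The two squares of colour `κ` at a vertex are diagonally opposite there. Which diagonal they lie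
on is decided by the parity `q` of the address plus `κ`, and they are visited in turn. -/
theorem Search.expand (hs : Setting B l R) (hκ : κ = 0 ∨ κ = 1) {Q : List (ℤ × ℤ)} {σ : State}
    (h : Search l R κ ans Q σ) {i : ℕ} (hi : i < Q.length) (hσ : σ.reg 10 = 2 * l.length + i) :
    Terminates B expandProg 72 σ fun τ => ∃ Q', Search l R κ ans Q' τ ∧ Q <+: Q' ∧
      τ.reg 10 = 2 * l.length + (i + 1 : ℕ) ∧
      (∀ x ∈ Q', x ∈ Q ∨ TileAdj {v | v ∈ l} κ Q[i] x) ∧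
      ∀ x, TileAdj {v | v ∈ l} κ Q[i] x → x ∈ Q' := by
  have hv := h.queue i hi
  have hvl : Q[i] ∈ l := h.subset (List.getElem_mem hi)
  generalize Q[i] = v at hv hvl ⊢
  have hcoord := hs.coord v hvl
  have hvr := hs.inRange hvl
  have bv := hs.addr_bound hvr
  have hge := hs.addr_ge hvr
  have hto := hs.addr_toNat hvr
  have ⟨w1, w2, w3⟩ := hs.width
  have hlen : i < l.length := hi.trans_le (h.nodup.subperm h.subset).length_le
  have hRlen := hs.length_lt
  have hpar := addr_emod_two R v
  obtain ⟨q, hq⟩ : ∃ q, q = (addr R v + κ) % 2 := ⟨_, rfl⟩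
  have hq01 : q = 0 ∨ q = 1 := by omega
  have hcor1 : Corner (v.1 - q, v.2) v := by simp only [Corner]; omega
  have hcor2 : Corner (v.1 - 1 + q, v.2 - 1) v := by simp only [Corner]; omega
  have hsq : ∀ s : ℤ × ℤ, Corner s v → (s.1 + s.2 + κ) % 2 = 1 →
      s = (v.1 - q, v.2) ∨ s = (v.1 - 1 + q, v.2 - 1) := fun s hs hsc => by
    simp only [Corner, Prod.ext_iff] at hs ⊢
    omega
  -- Coordinates of vertices are strictly below `R` in absolute value, so all squares touching a
  -- vertex still have their corners in the table.
  have hrange : ∀ s : ℤ × ℤ, Corner s v → ∀ p, Corner s p → InRange R p := fun s hs p hp => by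
    simp only [Corner, InRange] at *
    omega
  have ea1 : addr R (v.1 - q, v.2) = addr R v - q := by simp only [addr]; ring
  have ea2 : addr R (v.1 - 1 + q, v.2 - 1) = addr R v - (2 * R + 1) - 1 + q := by
    simp only [addr]; ring
  have b1 := hs.addr_bound (hrange _ hcor1 _ ((corner_iff _ _).2 (.inl rfl)))
  have b2 := hs.addr_bound (hrange _ hcor2 _ ((corner_iff _ _).2 (.inl rfl)))
  refine .load_seq (2 * l.length + i) _ (by simp [hσ]) hv ?_
  refine .op_seq (2 * l.length + (i + 1 : ℕ))
    (by simp [State.setReg_reg, BinOp.eval, h.reg1, hσ]; ring) (by constructor <;> omega) ?_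
  refine .op_seq (addr R v + κ) (by simp [State.setReg_reg, BinOp.eval, h.reg7])
    (by constructor <;> omega) ?_
  refine .op_seq ((addr R v + κ) / 2) (by simp [State.setReg_reg, BinOp.eval, h.reg2])
    (by constructor <;> omega) ?_
  refine .op_seq ((addr R v + κ) / 2 * 2) (by simp [State.setReg_reg, BinOp.eval, h.reg2])
    (by constructor <;> omega) ?_
  refine .op_seq q (by simp [State.setReg_reg, BinOp.eval]; omega)
    (by constructor <;> omega) ?_
  refine .op_seq (addr R v - q) (by simp [State.setReg_reg, BinOp.eval])
    (by constructor <;> omega) ?_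
  set σ₁ := State.setReg _ 14 (addr R v - q) with hσ₁
  have h₁ : Search l R κ ans Q σ₁ := h.congr (fun r hr hr' => by
    simp only [hσ₁, State.setReg_reg]
    repeat rw [if_neg (by omega)]) rfl
  have g10 : σ₁.reg 10 = 2 * l.length + (i + 1 : ℕ) := by simp [hσ₁, State.setReg_reg]
  have g12 : σ₁.reg 12 = addr R v := by simp [hσ₁, State.setReg_reg]
  have g13 : σ₁.reg 13 = q := by simp [hσ₁, State.setReg_reg]
  have g14 : σ₁.reg 14 = addr R (v.1 - q, v.2) := by simp [hσ₁, State.setReg_reg, ea1]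
  clear_value σ₁
  refine .seq (T₁ := 31) (T₂ := 34) ((h₁.visit hs (hrange _ hcor1) g14).mono le_rfl ?_)
  rintro τ₁ ⟨Q₁, h₂, p₂, m₂, c₂, f₂⟩
  refine .op_seq (addr R v - (2 * R + 1))
    (by simp [BinOp.eval, h₂.reg4, f₂ 12, g12])
    (by constructor <;> omega) ?_
  refine .op_seq (addr R v - (2 * R + 1) - 1)
    (by simp [BinOp.eval, State.setReg_reg, h₂.reg1]) (by constructor <;> omega) ?_
  refine .op_seq (addr R v - (2 * R + 1) - 1 + q)
    (by simp [BinOp.eval, State.setReg_reg, f₂ 13, g13])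
    (by constructor <;> omega) ?_
  set σ₂ := State.setReg _ 14 (addr R v - (2 * R + 1) - 1 + q) with hσ₂
  have hreg : ∀ r < 14, σ₂.reg r = τ₁.reg r := fun r hr => by
    simp only [hσ₂, State.setReg_reg]
    repeat rw [if_neg (by omega)]
  have h₃ : Search l R κ ans Q₁ σ₂ := h₂.congr (fun r hr _ => hreg r (by omega)) rfl
  have g14' : σ₂.reg 14 = addr R (v.1 - 1 + q, v.2 - 1) := by simp [hσ₂, State.setReg_reg, ea2]
  clear_value σ₂
  refine (h₃.visit hs (hrange _ hcor2) g14').mono le_rfl ?_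
  rintro τ₂ ⟨Q₂, h₄, p₄, m₄, c₄, f₄⟩
  refine ⟨Q₂, h₄, p₂.trans p₄, ?_, fun x hx => ?_, ?_⟩
  · rw [f₄ 10 (by omega) (by omega), hreg 10 (by omega), f₂ 10 (by omega) (by omega), g10]
  · rcases m₄ x hx with hx | ⟨hx, ha⟩
    · rcases m₂ x hx with hx | ⟨hx, ha⟩
      · exact .inl hx
      · exact .inr ⟨_, ⟨by simp only; omega, ha⟩, hcor1, hx⟩
    · exact .inr ⟨_, ⟨by simp only; omega, ha⟩, hcor2, hx⟩
  · rintro x ⟨s, hs, hsv, hsx⟩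
    rcases hsq s hsv hs.1 with rfl | rfl
    · exact p₄.subset (c₂ hs.2 x hsx)
    · exact c₄ hs.2 x hsx


/-! ### A full pass for one colour -/

/-- All table cells outside the vertex set are zero. -/
def Clean (l : List (ℤ × ℤ)) (R : ℤ) (σ : State) : Prop :=
  ∀ p, InRange R p → p ∉ l → σ.mem (addr R p).toNat = 0

/-- Writing 1 at every vertex also erases the marks 2 of an earlier pass; the other cells never
became nonzero, so the cost is linear in the number of points, not in the size of the table. -/
theorem Base.init (hs : Setting B l R) {σ : State} (h : Base l R κ ans σ) (hc : Clean l R σ) :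
    Terminates B initProg (9 * l.length + 2) σ fun τ =>
      Base l R κ ans τ ∧ Clean l R τ ∧ ∀ p ∈ l, τ.mem (addr R p).toNat = 1 := by
  have ⟨w1, w2, w3⟩ := hs.width
  have hlen := hs.length_lt
  have hb := hs.bound
  refine .const_seq (by constructor <;> omega) ?_
  refine .loop (T := 8) (fun k τ => ∃ i, k + i = l.length ∧ Base l R κ ans τ ∧ τ.reg 10 = 2 * i ∧
    Clean l R τ ∧ ∀ j (hj : j < l.length), j < i → τ.mem (addr R l[j]).toNat = 1) ?_ ?_ ?_
  · refine ⟨0, rfl, h.congr (fun r hr => ?_) fun _ _ => rfl, ?_, hc, by simp⟩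
    · rw [State.setReg_reg, if_neg (by omega)]
    · simp [State.setReg_reg]
  · rintro k τ ⟨i, hk, hb', h10, hcl, hm⟩ ht
    simp only [Test.Holds, h10, hb'.reg6] at ht
    have hi : i < l.length := by omega
    refine ⟨k - 1, by omega, ?_⟩
    obtain ⟨hx, hy⟩ := hb'.input i hi
    have hpl : l[i] ∈ l := List.getElem_mem hi
    obtain ⟨p, hp⟩ : ∃ p, p = l[i] := ⟨_, rfl⟩
    rw [← hp] at hx hy hpl
    have hcoord := hs.coord p hpl
    have hpr := hs.inRange hpl
    have hto := hs.addr_toNat hpr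
    have hge := hs.addr_ge hpr
    have hab := hs.addr_bound hpr
    have hmul : -((2 * R + 1) ^ 2) ≤ p.2 * (2 * R + 1) ∧ p.2 * (2 * R + 1) ≤ (2 * R + 1) ^ 2 := by
      constructor <;> nlinarith
    have haddr : p.1 + p.2 * (2 * R + 1) + (2 * R + 1) ^ 2 = addr R p := by
      simp only [addr]; ring
    refine .load_seq (2 * i) _ (by simp [h10]) hx ?_
    refine .op_seq (2 * i + 1) (by simp [State.setReg_reg, BinOp.eval, h10, hb'.reg1])
      (by constructor <;> omega) ?_
    refine .load_seq (2 * i + 1) _ (by simp [State.setReg_reg]) hy ?_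
    refine .op_seq (2 * (i + 1)) (by simp [State.setReg_reg, BinOp.eval, hb'.reg1]; ring)
      (by constructor <;> omega) ?_
    refine .op_seq (p.2 * (2 * R + 1)) (by simp [State.setReg_reg, BinOp.eval, hb'.reg4])
      (by constructor <;> omega) ?_
    refine .op_seq (p.1 + p.2 * (2 * R + 1)) (by simp [State.setReg_reg, BinOp.eval])
      (by constructor <;> omega) ?_
    refine .op_seq (addr R p) (by simp [State.setReg_reg, BinOp.eval, hb'.reg5, haddr])
      (by constructor <;> omega) ?_
    refine .store (addr R p).toNat 1 (by simp [State.setReg_reg, hto])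
      (by simp [State.setReg_reg, hb'.reg1]) ?_
    refine ⟨i + 1, by omega, hb'.congr (fun r hr => ?_) (fun a ha => ?_), ?_, ?_, ?_⟩
    · simp only [State.setMem_reg, State.setReg_reg]
      repeat rw [if_neg (by omega)]
    · rw [State.setMem_mem, if_neg (by omega)]
      rfl
    · simp [State.setReg_reg]
    · intro x hx hxl
      rw [State.setMem_mem, if_neg fun e => hxl (((hs.toNat_inj hx hpr).1 e).symm ▸ hpl)]
      exact hcl x hx hxl
    · intro j hj hji
      rw [State.setMem_mem]
      split_ifs with he
      · rfl
      · refine hm j hj ?_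
        rcases Nat.lt_succ_iff_lt_or_eq.1 hji with h | rfl
        · exact h
        · exact absurd (by rw [hp]) he
  · rintro k τ ⟨i, hk, hb', h10, hcl, hm⟩ ht
    simp only [Test.Holds, h10, hb'.reg6] at ht
    refine ⟨hb', hcl, fun p hp => ?_⟩
    obtain ⟨j, hj, rfl⟩ := List.getElem_of_mem hp
    exact hm j hj (by omega)

/-- All vertices can be reached from the first one through pixels of colour `κ`. -/
def Reaches (l : List (ℤ × ℤ)) (κ : ℤ) : Prop :=
  ∀ v ∈ l.head?, ∀ w ∈ l, Relation.ReflTransGen (TileAdj {v | v ∈ l} κ) v w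

/-- Each round expands one queue entry and entries never repeat, so there are at most `l.length`
rounds. At exhaustion the queue is the set reachable from the first vertex, and comparing its length
with `l.length` decides `Reaches`. A failed search leaves register 8 alone, so that two passes
compute a disjunction. -/
theorem Base.search (hs : Setting B l R) (hκ : κ = 0 ∨ κ = 1) {σ : State} (h : Base l R κ ans σ)
    (hc : Clean l R σ) (hm : ∀ p ∈ l, σ.mem (addr R p).toNat = 1) :
    Terminates B searchProg (73 * l.length + 13) σ fun τ =>
      Clean l R τ ∧ ∃ ans', Base l R κ ans' τ ∧
        (Reaches l κ ∧ ans' = 1 ∨ ¬Reaches l κ ∧ ans' = ans) := by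
  have ⟨w1, w2, w3⟩ := hs.width
  have hlen := hs.length_lt
  have hlen2 := hs.two_le
  have hb := hs.bound
  obtain ⟨v, l', hl⟩ : ∃ v l', l = v :: l' := List.exists_cons_of_length_pos (by omega)
  have hvl : v ∈ l := by simp [hl]
  have hR : Reaches l κ ↔ ∀ w ∈ l, Relation.ReflTransGen (TileAdj {v | v ∈ l} κ) v w := by
    simp [Reaches, hl]
  rw [hR]
  have hin : σ.mem 0 = v.1 ∧ σ.mem 1 = v.2 := by
    simpa [hl] using h.input 0 (by omega)
  have hcoord := hs.coord v hvl
  have hpr := hs.inRange hvl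
  have hto := hs.addr_toNat hpr
  have hge := hs.addr_ge hpr
  have hab := hs.addr_bound hpr
  have hmul : -((2 * R + 1) ^ 2) ≤ v.2 * (2 * R + 1) ∧ v.2 * (2 * R + 1) ≤ (2 * R + 1) ^ 2 := by
    constructor <;> nlinarith
  have haddr : v.1 + v.2 * (2 * R + 1) + (2 * R + 1) ^ 2 = addr R v := by
    simp only [addr]; ring
  refine Terminates.mono (T₁ := (73 * l.length + 1 + 3) + 9) ?_ (by omega) (fun _ h => h)
  refine .load_seq 0 _ (by simp [h.reg9]) hin.1 ?_
  refine .load_seq 1 _ (by simp [State.setReg_reg, h.reg1]) hin.2 ?_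
  refine .op_seq (v.2 * (2 * R + 1)) (by simp [State.setReg_reg, BinOp.eval, h.reg4])
    (by constructor <;> omega) ?_
  refine .op_seq (v.1 + v.2 * (2 * R + 1)) (by simp [State.setReg_reg, BinOp.eval])
    (by constructor <;> omega) ?_
  refine .op_seq (addr R v) (by simp [State.setReg_reg, BinOp.eval, h.reg5, haddr])
    (by constructor <;> omega) ?_
  refine .store_seq (addr R v).toNat 2 (by simp [State.setReg_reg, hto])
    (by simp [State.setReg_reg, h.reg2]) ?_
  refine .store_seq (2 * l.length) (addr R v) (by simp [State.setReg_reg, h.reg6])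
    (by simp [State.setReg_reg]) ?_
  refine .op_seq (2 * l.length) (by simp [State.setReg_reg, BinOp.eval, h.reg6, h.reg9])
    (by constructor <;> omega) ?_
  refine .op_seq (2 * l.length + 1) (by simp [State.setReg_reg, BinOp.eval, h.reg6, h.reg1])
    (by constructor <;> omega) ?_
  set σ₁ := State.setReg _ 11 (2 * (l.length : ℤ) + 1) with hσ₁
  have h₁ : Search l R κ ans [v] σ₁ :=
    { h.congr (τ := σ₁) (fun r hr => by
        simp only [hσ₁, State.setMem_reg, State.setReg_reg]
        repeat rw [if_neg (by omega)]) (fun a ha => by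
        simp only [hσ₁, State.setReg_mem, State.setMem_mem]
        repeat rw [if_neg (by omega)]) with
      tail := by simp [hσ₁, State.setReg_reg]
      table := fun p hp => by
        have := hs.addr_ge hp
        simp only [hσ₁, State.setReg_mem, State.setMem_mem, hs.toNat_inj hp hpr,
          List.mem_singleton]
        rw [if_neg (by omega)]
        by_cases hpv : p = v
        · simp [hpv]
        · by_cases hpl : p ∈ l
          · simp [hpv, hpl, hm p hpl]
          · simp [hpv, hpl, hc p hp hpl]
      queue := fun j hj => by
        obtain rfl : j = 0 := by simpa using hj
        simp [hσ₁, State.setMem_mem]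
      nodup := by simp
      subset := by simpa using hvl }
  have g10 : σ₁.reg 10 = 2 * l.length + (0 : ℕ) := by simp [hσ₁, State.setReg_reg]
  clear_value σ₁
  refine .seq (T₁ := 73 * l.length + 1) (T₂ := 3) ?_
  -- Here `i` counts the expanded entries: everything queued is reachable, and the neighbours of the
  -- first `i` entries are queued already.
  refine .loop (T := 72) (fun k τ => ∃ Q i, k + i = l.length ∧ i ≤ Q.length ∧
    Search l R κ ans Q τ ∧ τ.reg 10 = 2 * l.length + (i : ℕ) ∧ v ∈ Q ∧
    (∀ x ∈ Q, Relation.ReflTransGen (TileAdj {v | v ∈ l} κ) v x) ∧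
    ∀ j (hj : j < Q.length), j < i → ∀ w, TileAdj {v | v ∈ l} κ Q[j] w → w ∈ Q) ?_ ?_ ?_
  · exact ⟨[v], 0, rfl, by simp, h₁, g10, by simp, by simp [Relation.ReflTransGen.refl], by simp⟩
  · rintro k τ ⟨Q, i, hk, hiQ, hS, h10, hvQ, hreach, hclosed⟩ ht
    simp only [Test.Holds, h10, hS.tail] at ht
    have hi : i < Q.length := by omega
    have hQl : Q.length ≤ l.length := (hS.nodup.subperm hS.subset).length_le
    refine ⟨k - 1, by omega, (hS.expand hs hκ hi h10).mono le_rfl ?_⟩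
    rintro τ' ⟨Q', hS', hpre, h10', hnew, hall⟩
    have hget : ∀ j (hj : j < Q.length), Q'[j]'(hj.trans_le hpre.length_le) = Q[j] :=
      fun j hj => (hpre.getElem hj).symm
    refine ⟨Q', i + 1, by omega, by have := hpre.length_le; omega, hS', h10', hpre.subset hvQ,
      fun x hx => ?_, fun j hj hji w hw => ?_⟩
    · rcases hnew x hx with hx | hx
      · exact hreach x hx
      · exact (hreach _ (List.getElem_mem hi)).tail hx
    · have hjQ : j < Q.length := by omega
      rw [hget j hjQ] at hw
      rcases Nat.lt_succ_iff_lt_or_eq.1 hji with h | rfl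
      · exact hpre.subset (hclosed j hjQ h w hw)
      · exact hall w hw
  · rintro k τ ⟨Q, i, hk, hiQ, hS, h10, hvQ, hreach, hclosed⟩ ht
    simp only [Test.Holds, h10, hS.tail] at ht
    obtain rfl : i = Q.length := by omega
    have hQl : Q.length ≤ l.length := (hS.nodup.subperm hS.subset).length_le
    have hQreach : ∀ w, Relation.ReflTransGen (TileAdj {v | v ∈ l} κ) v w → w ∈ Q := by
      intro w hw
      induction hw with
      | refl => exact hvQ
      | tail _ hbc ih =>
        obtain ⟨j, hj, rfl⟩ := List.getElem_of_mem ih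
        exact hclosed j hj hj _ hbc
    have hiff : (∀ w ∈ l, Relation.ReflTransGen (TileAdj {v | v ∈ l} κ) v w) ↔
        Q.length = l.length := by
      constructor
      · intro hw
        have : l ⊆ Q := fun w hwl => hQreach w (hw w hwl)
        exact le_antisymm hQl (hs.nodup.subperm this).length_le
      · intro he w hw
        have hperm := (hS.nodup.subperm hS.subset).perm_of_length_le he.ge
        exact hreach w (hperm.mem_iff.2 hw)
    rw [hiff]
    have hclean : Clean l R τ := fun p hp hpl => by
      rw [hS.table p hp, if_neg (fun h => hpl (hS.subset h)), if_neg hpl]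
    refine .op_seq Q.length (by simp [BinOp.eval, hS.tail, hS.reg6]) (by constructor <;> omega) ?_
    have hS' : Search l R κ ans Q (τ.setReg 16 Q.length) :=
      hS.congr (fun r hr _ => by rw [State.setReg_reg, if_neg (by omega)]) rfl
    have g16 : (τ.setReg 16 Q.length).reg 16 = Q.length := by simp [State.setReg_reg]
    refine .ite (fun hb => ?_) fun hb => ?_
    · simp only [Test.Holds, g16, hS'.reg0, Nat.cast_inj] at hb
      refine .const (by constructor <;> omega) ⟨hclean, 1, ?_, .inl ⟨hb, rfl⟩⟩
      have hh : ∀ r, r ≠ 8 → ((τ.setReg 16 Q.length).setReg 8 1).reg r =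
          (τ.setReg 16 Q.length).reg r := fun r hr => by rw [State.setReg_reg, if_neg hr]
      exact
        { reg0 := (hh 0 (by omega)).trans hS'.reg0
          reg1 := (hh 1 (by omega)).trans hS'.reg1
          reg2 := (hh 2 (by omega)).trans hS'.reg2
          reg4 := (hh 4 (by omega)).trans hS'.reg4
          reg5 := (hh 5 (by omega)).trans hS'.reg5
          reg6 := (hh 6 (by omega)).trans hS'.reg6
          reg7 := (hh 7 (by omega)).trans hS'.reg7
          reg8 := by simp [State.setReg_reg]
          reg9 := (hh 9 (by omega)).trans hS'.reg9
          input := hS'.input }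
    · simp only [Test.Holds, g16, hS'.reg0, Nat.cast_inj] at hb
      exact .skip ⟨hclean, ans, hS'.toBase, .inr ⟨hb, rfl⟩⟩

end

/-! ### Reading the input and choosing the table size -/

theorem inputMagnitude_spec (l : List (ℤ × ℤ)) : l.length ≤ inputMagnitude l ∧
    ∀ p ∈ l, p.1.natAbs ≤ inputMagnitude l ∧ p.2.natAbs ≤ inputMagnitude l := by
  have key : ∀ (l : List (ℤ × ℤ)) (b : ℕ),
      b ≤ l.foldr (fun p m => max (max p.1.natAbs p.2.natAbs) m) b ∧
      ∀ p ∈ l, p.1.natAbs ≤ l.foldr (fun p m => max (max p.1.natAbs p.2.natAbs) m) b ∧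
        p.2.natAbs ≤ l.foldr (fun p m => max (max p.1.natAbs p.2.natAbs) m) b := by
    intro l b
    induction l with
    | nil => simp
    | cons q l ih =>
      simp only [List.foldr_cons, List.mem_cons, forall_eq_or_imp]
      refine ⟨ih.1.trans (le_max_right _ _), ⟨?_, ?_⟩, fun p hp => ?_⟩
      · exact (le_max_left _ _).trans (le_max_left _ _)
      · exact (le_max_right _ _).trans (le_max_left _ _)
      · exact ⟨(ih.2 p hp).1.trans (le_max_right _ _), (ih.2 p hp).2.trans (le_max_right _ _)⟩
  exact key l l.length

theorem inputState_mem (l : List (ℤ × ℤ)) {j : ℕ} (hj : j < l.length) :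
    (inputState l).mem (2 * j) = l[j].1 ∧ (inputState l).mem (2 * j + 1) = l[j].2 := by
  have h1 : (2 * j + 1) / 2 = j := by omega
  simp [inputState, h1, hj]

theorem inputState_mem_of_le (l : List (ℤ × ℤ)) {a : ℕ} (ha : 2 * l.length ≤ a) :
    (inputState l).mem a = 0 := by
  have : l.length ≤ a / 2 := by omega
  simp [inputState, this]

theorem inputState_mem_le (l : List (ℤ × ℤ)) (a : ℕ) :
    |(inputState l).mem a| ≤ inputMagnitude l := by
  rcases Nat.lt_or_ge (a / 2) l.length with h | h
  · have h1 := inputState_mem l h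
    have h2 := (inputMagnitude_spec l).2 _ (List.getElem_mem h)
    rcases Nat.mod_two_eq_zero_or_one a with h3 | h3
    · rw [show a = 2 * (a / 2) by omega, h1.1, Int.abs_eq_natAbs]
      exact_mod_cast h2.1
    · rw [show a = 2 * (a / 2) + 1 by omega, h1.2, Int.abs_eq_natAbs]
      exact_mod_cast h2.2
  · rw [inputState_mem_of_le l (by omega)]
    simp

-- The value chosen for `R` is the number of points plus 1 plus the sum of the squares of all
-- coordinates. It is cubic in the input magnitude, so the addresses are polynomially bounded.
set_option maxHeartbeats 600000 in
theorem setup_terminates {l : List (ℤ × ℤ)} (hl : l.Nodup) (h2 : 2 ≤ l.length) :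
    Terminates ((inputMagnitude l + 2) ^ 14) setupProg (10 * l.length + 7)
      ((inputState l).setReg 2 2) fun τ =>
      ∃ R, Setting ((inputMagnitude l + 2) ^ 14) l R ∧ Base l R 0 0 τ ∧ Clean l R τ := by
  obtain ⟨hn, hp⟩ := inputMagnitude_spec l
  have hmem := inputState_mem_le l
  set B := (inputMagnitude l + 2) ^ 14 with hB
  obtain ⟨M, hM⟩ : ∃ M : ℤ, M = (inputMagnitude l : ℤ) := ⟨_, rfl⟩
  rw [← hM] at hmem
  have hn' : (l.length : ℤ) ≤ M := by omega
  have hM2 : 2 ≤ M := by omega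
  -- With `c = (M + 2) ^ 3` the row width is at most `c ^ 2`, its square at most `(M + 2) ^ 12`, and
  -- the factor 4 in `Setting.bound` is absorbed by `(M + 2) ^ 2`. This is the exponent 14.
  obtain ⟨c, hc⟩ : ∃ c, c = (M + 2) ^ 3 := ⟨_, rfl⟩
  have hc8 : 64 ≤ c := by
    rw [hc]
    exact (pow_le_pow_left₀ (by norm_num) (show (4 : ℤ) ≤ M + 2 by omega) 3).trans' (by norm_num)
  have hBc : 4 * (c ^ 2) ^ 2 ≤ (B : ℤ) := by
    have : (B : ℤ) = (M + 2) ^ 2 * (c ^ 2) ^ 2 := by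
      rw [hB, hc, hM]; push_cast; ring
    rw [this]
    exact mul_le_mul_of_nonneg_right (by nlinarith) (by positivity)
  have hc2 : 64 * c ≤ c ^ 2 := by nlinarith
  have hc4 : c ^ 2 ≤ (c ^ 2) ^ 2 := by nlinarith
  have hMM : 2 * l.length * M ^ 2 + M + 1 ≤ 2 * c := by
    have : 2 * l.length * M ^ 2 ≤ 2 * M * M ^ 2 :=
      mul_le_mul_of_nonneg_right (by omega) (by positivity)
    rw [hc]
    nlinarith
  have hMc : 2 * M + 2 ≤ c := by
    rw [hc]
    nlinarith [pow_pos (show 0 < M by omega) 3, pow_pos (show 0 < M by omega) 2]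
  have hM1 : M ^ 2 ≤ 2 * c := by rw [hc]; nlinarith
  refine Terminates.mono (T₁ := (10 * l.length + 1 + 3) + 3) ?_ (by omega) (fun _ h => h)
  refine .const_seq (by constructor <;> omega) ?_
  refine .op_seq (l.length + 1) (by simp [State.setReg_reg, BinOp.eval, inputState])
    (by constructor <;> omega) ?_
  refine .op_seq (2 * l.length)
    (by simp [State.setReg_reg, BinOp.eval, inputState]; ring)
    (by constructor <;> omega) ?_
  refine .seq (T₁ := 10 * l.length + 1) (T₂ := 3) ?_
  rw [show 10 * l.length + 1 = (4 + 1) * (2 * l.length) + 1 by ring]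
  set σ₀ := State.setReg _ 6 (2 * (l.length : ℤ)) with hσ₀
  have f0 : σ₀.reg 0 = l.length := by simp [hσ₀, State.setReg_reg, inputState]
  have f1 : σ₀.reg 1 = 1 := by simp [hσ₀, State.setReg_reg]
  have f2 : σ₀.reg 2 = 2 := by simp [hσ₀, State.setReg_reg]
  have f3 : σ₀.reg 3 = l.length + 1 := by simp [hσ₀, State.setReg_reg]
  have f6 : σ₀.reg 6 = 2 * l.length := by simp [hσ₀, State.setReg_reg]
  have f7 : σ₀.reg 7 = 0 := by simp [hσ₀, State.setReg_reg, inputState]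
  have f8 : σ₀.reg 8 = 0 := by simp [hσ₀, State.setReg_reg, inputState]
  have f9 : σ₀.reg 9 = 0 := by simp [hσ₀, State.setReg_reg, inputState]
  have f10 : σ₀.reg 10 = 0 := by simp [hσ₀, State.setReg_reg, inputState]
  have fm : σ₀.mem = (inputState l).mem := rfl
  clear_value σ₀
  refine .loop (fun k τ => ∃ i : ℕ, k + i = 2 * l.length ∧ τ.reg 10 = i ∧ l.length + 1 ≤ τ.reg 3 ∧
    τ.reg 3 ≤ l.length + 1 + i * M ^ 2 ∧ (∀ j < i, |(inputState l).mem j| < τ.reg 3) ∧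
    τ.mem = (inputState l).mem ∧ ∀ r < 10, r ≠ 3 → τ.reg r = σ₀.reg r) ?_ ?_ ?_
  · exact ⟨0, rfl, f10, f3.ge, by simp [f3], by simp, fm, fun _ _ _ => rfl⟩
  · rintro k τ ⟨i, hk, h10, h3, h3', hj, hm, hr⟩ ht
    simp only [Test.Holds, h10, hr 6 (by omega) (by omega), f6] at ht
    have hi : i < 2 * l.length := by omega
    obtain ⟨z, hz⟩ : ∃ z, (inputState l).mem i = z := ⟨_, rfl⟩
    have hzM := hmem i
    rw [hz] at hzM
    have hzz : z * z ≤ M ^ 2 := by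
      rw [← sq, ← sq_abs]
      exact pow_le_pow_left₀ (abs_nonneg z) hzM 2
    have hz0 : 0 ≤ z * z := mul_self_nonneg z
    -- For integers the square dominates the absolute value, so no sign test is needed.
    have hzle : |z| ≤ z * z := by
      rw [← sq, Int.abs_eq_natAbs]
      exact Int.natAbs_le_self_sq z
    have hstep : ((i : ℤ) + 1) * M ^ 2 ≤ 2 * l.length * M ^ 2 :=
      mul_le_mul_of_nonneg_right (by omega) (by positivity)
    have hexp : ((i : ℤ) + 1) * M ^ 2 = i * M ^ 2 + M ^ 2 := by ring
    refine ⟨k - 1, by omega, ?_⟩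
    refine .load_seq i z (by simp [h10]) (by rw [hm, hz]) ?_
    refine .op_seq (z * z) (by simp [State.setReg_reg, BinOp.eval]) (by constructor <;> omega) ?_
    refine .op_seq (τ.reg 3 + z * z) (by simp [State.setReg_reg, BinOp.eval])
      (by constructor <;> omega) ?_
    refine .op (i + 1 : ℕ)
      (by simp [State.setReg_reg, BinOp.eval, h10, hr 1 (by omega) (by omega), f1])
      (by constructor <;> omega) ?_
    refine ⟨i + 1, by omega, by simp [State.setReg_reg], ?_, ?_, fun j hji => ?_, hm,
      fun r hr1 hr2 => ?_⟩
    · simp only [State.setReg_reg, if_true, show (3 : ℕ) ≠ 10 by omega, if_false]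
      omega
    · simp only [State.setReg_reg, if_true, show (3 : ℕ) ≠ 10 by omega, if_false]
      push_cast
      linarith
    · simp only [State.setReg_reg, if_true, show (3 : ℕ) ≠ 10 by omega, if_false]
      rcases Nat.lt_succ_iff_lt_or_eq.1 hji with h | rfl
      · linarith [hj j h]
      · rw [hz]
        linarith
    · rw [← hr r hr1 hr2]
      simp only [State.setReg_reg]
      repeat rw [if_neg (by omega)]
  · rintro k τ ⟨i, hk, h10, h3, h3', hj, hm, hr⟩ ht
    simp only [Test.Holds, h10, hr 6 (by omega) (by omega), f6] at ht
    obtain rfl : i = 2 * l.length := by omega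
    obtain ⟨R, hR⟩ : ∃ R, τ.reg 3 = R := ⟨_, rfl⟩
    rw [hR] at h3 h3' hj
    push_cast at h3'
    have hRc : 2 * R + 1 ≤ c ^ 2 := by omega
    have hRc' : (2 * R + 1) ^ 2 ≤ (c ^ 2) ^ 2 := pow_le_pow_left₀ (by omega) hRc 2
    have hs : Setting B l R :=
      { two_le := h2
        nodup := hl
        length_lt := by omega
        coord := fun p hp => by
          obtain ⟨j, hjl, rfl⟩ := List.getElem_of_mem hp
          have h1 := hj (2 * j) (by omega)
          have h2 := hj (2 * j + 1) (by omega)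
          rw [(inputState_mem l hjl).1, abs_lt] at h1
          rw [(inputState_mem l hjl).2, abs_lt] at h2
          exact ⟨h1.1, h1.2, h2.1, h2.2⟩
        bound := by linarith }
    refine .op_seq (2 * R) (by simp [BinOp.eval, hR]; ring) (by constructor <;> omega) ?_
    refine .op_seq (2 * R + 1)
      (by simp [State.setReg_reg, BinOp.eval, hr 1 (by omega) (by omega), f1])
      (by constructor <;> omega) ?_
    refine .op ((2 * R + 1) ^ 2) (by simp [State.setReg_reg, BinOp.eval]; ring)
      (by constructor <;> nlinarith) ?_
    refine ⟨R, hs, ?_, ?_⟩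
    · constructor
      case input => exact fun j hj => by simpa [hm] using inputState_mem l hj
      all_goals simp [State.setReg_reg, hr, f0, f1, f2, f6, f7, f8, f9]
    · intro p hp hpl
      have := hs.addr_ge hp
      simp only [State.setReg_mem, hm]
      exact inputState_mem_of_le l (by omega)

/-! ### The criterion and the decision procedure -/

theorem hasDoubleTurningCycle_iff_reaches {l : List (ℤ × ℤ)} (hl : l.Nodup)
    (hV : IsSolid {v | v ∈ l}) :
    HasDoubleTurningCycle {v | v ∈ l} ↔ 2 ≤ l.length ∧ (Reaches l 0 ∨ Reaches l 1) := by
  constructor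
  · intro h
    obtain ⟨⟨x, hx, y, hy, hxy⟩, κ, hκ, hreach⟩ := h.exists_reachable hV
    have hR : Reaches l κ := fun v hv w hw => hreach v (List.mem_of_mem_head? hv) w hw
    refine ⟨?_, ?_⟩
    · have : [x, y].Nodup := by simp [hxy]
      exact (this.subperm (l₂ := l) (by simpa using ⟨hx, hy⟩)).length_le
    · rcases hκ with rfl | rfl
      exacts [.inl hR, .inr hR]
  · rintro ⟨h2, h⟩
    obtain ⟨v, w, l', rfl⟩ : ∃ v w l', l = v :: w :: l' := by
      match l, h2 with
      | v :: w :: l', _ => exact ⟨v, w, l', rfl⟩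
    have hne : v ≠ w := by
      simp only [List.nodup_cons, List.mem_cons, not_or] at hl
      exact hl.1.1
    have hnt : {u | u ∈ v :: w :: l'}.Nontrivial := ⟨v, by simp, w, by simp, hne⟩
    have hfin : {u | u ∈ v :: w :: l'}.Finite := List.finite_toSet _
    rcases h with h | h
    all_goals exact hasDoubleTurningCycle_of_reachable hfin hnt fun u hu => h v (by simp) u hu

end DoubleTurning

open DoubleTurning in
/-- There is one random access machine program that decides, for every finite solid square grid
graph (given by the list of its vertices in any order), whether the graph has a double turning
Hamiltonian cycle. It takes a number of steps linear in the number of vertices, on words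
of a length logarithmic in the numbers of the input, and answers in register `0`. -/
theorem mainTheorem10 :
    ∃ (P : DoubleTurning.Prog) (c k : ℕ), ∀ l : List (ℤ × ℤ), l.Nodup →
      DoubleTurning.IsSolid {v | v ∈ l} →
      ∃ (t : ℕ) (τ : DoubleTurning.State),
        DoubleTurning.Exec ((DoubleTurning.inputMagnitude l + 2) ^ k) P
          (DoubleTurning.inputState l) t τ ∧
        t ≤ c * (l.length + 1) ∧
        (DoubleTurning.HasDoubleTurningCycle {v | v ∈ l} ∧ τ.reg 0 = 1 ∨
          ¬ DoubleTurning.HasDoubleTurningCycle {v | v ∈ l} ∧ τ.reg 0 = 0) := by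
  refine ⟨mainProg, 200, 14, fun l hl hV => ?_⟩
  rw [hasDoubleTurningCycle_iff_reaches hl hV]
  change Terminates _ _ _ _ fun τ => _
  have hB : (2 : ℤ) ≤ ((inputMagnitude l + 2) ^ 14 : ℕ) := by
    have h1 : 2 ≤ inputMagnitude l + 2 := by omega
    exact_mod_cast h1.trans (Nat.le_self_pow (by omega) _)
  refine Terminates.mono (T₁ := (174 * l.length + 50) + 1 + 1) ?_ (by omega) (fun _ h => h)
  refine .const_seq (by constructor <;> omega) (.ite (fun h => ?_) fun h => ?_)
  -- Fewer than two points must be rejected separately: for them `Reaches` holds trivially, but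
  -- there is no cycle.
  · simp only [Test.Holds, State.setReg_reg, inputState] at h
    refine Terminates.const (T := 174 * l.length + 49) (by constructor <;> omega) (.inr ⟨?_, ?_⟩)
    · norm_num at h
      omega
    · simp [State.setReg_reg]
  · simp only [Test.Holds, State.setReg_reg, inputState] at h
    have h2 : 2 ≤ l.length := by
      norm_num at h
      omega
    refine Terminates.mono (T₁ := (10 * l.length + 7) + ((9 * l.length + 2) + ((73 * l.length + 13) +
      (((9 * l.length + 2) + ((73 * l.length + 13) + 1)) + 1)))) ?_ (by omega) (fun _ h => h)
    refine .seq ((setup_terminates hl h2).mono le_rfl ?_)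
    rintro τ₁ ⟨R, hs, hb₁, hc₁⟩
    refine .seq ((hb₁.init hs hc₁).mono le_rfl ?_)
    rintro τ₂ ⟨hb₂, hc₂, hm₂⟩
    refine .seq ((hb₂.search hs (.inl rfl) hc₂ hm₂).mono le_rfl ?_)
    rintro τ₃ ⟨hc₃, a₀, hb₃, ha₀⟩
    refine .const_seq (by constructor <;> omega) ?_
    have hb₄ : Base l R 1 a₀ (τ₃.setReg 7 1) := by
      have hh : ∀ r, r ≠ 7 → (τ₃.setReg 7 1).reg r = τ₃.reg r := fun r hr => by
        rw [State.setReg_reg, if_neg hr]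
      exact
        { reg0 := (hh 0 (by omega)).trans hb₃.reg0
          reg1 := (hh 1 (by omega)).trans hb₃.reg1
          reg2 := (hh 2 (by omega)).trans hb₃.reg2
          reg4 := (hh 4 (by omega)).trans hb₃.reg4
          reg5 := (hh 5 (by omega)).trans hb₃.reg5
          reg6 := (hh 6 (by omega)).trans hb₃.reg6
          reg7 := by simp [State.setReg_reg]
          reg8 := (hh 8 (by omega)).trans hb₃.reg8
          reg9 := (hh 9 (by omega)).trans hb₃.reg9
          input := hb₃.input }
    refine .seq ((hb₄.init hs hc₃).mono le_rfl ?_)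
    rintro τ₅ ⟨hb₅, hc₅, hm₅⟩
    refine .seq ((hb₅.search hs (.inr rfl) hc₅ hm₅).mono le_rfl ?_)
    rintro τ₆ ⟨hc₆, a₁, hb₆, ha₁⟩
    have ha01 : a₁ = 0 ∨ a₁ = 1 := by
      rcases ha₀ with ⟨-, h⟩ | ⟨-, h⟩ <;> rcases ha₁ with ⟨-, h'⟩ | ⟨-, h'⟩ <;> omega
    -- Register 9 is zero, so this addition copies the answer from register 8 to register 0.
    refine Terminates.op (T := 0) a₁ (by simp [BinOp.eval, hb₆.reg8, hb₆.reg9])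
      (by constructor <;> omega) ?_
    simp only [State.setReg_reg, if_true]
    rcases ha₁ with ⟨h1, e1⟩ | ⟨h1, e1⟩
    · exact .inl ⟨⟨h2, .inr h1⟩, e1⟩
    · rcases ha₀ with ⟨h0, e0⟩ | ⟨h0, e0⟩
      · exact .inl ⟨⟨h2, .inl h0⟩, e1.trans e0⟩
      · exact .inr ⟨fun h => h.2.elim h0 h1, e1.trans e0⟩
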